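/- \textbf{Block-factor field.} Let $x_1,x_2,y_1,y_2\ge 0$, $m_1,m_2\ge 2$ and $L_1,L_2\ge 1$ be integers; put $c_1=x_1+x_2+1$, $c_2=y_1+y_2+1$, $b_s=m_s+c_s-2$, $\tilde N_s=(L_s+1)b_s$ and $N_s=\tilde N_s-c_s+1$ for $s\in\{1,2\}$. Let $\{\tilde X_{i,j}: 1\le i\le\tilde N_1,\ 1\le j\le\tilde N_2\}$ be i.i.d. real random variables (if $L_s=1$, the i.i.d. family is taken with $3b_s$ instead of $\tilde N_s=2b_s$ sites in direction $s$, so that all probabilities below make sense), let $T$ be a measurable real function on real $c_2\times c_1$ matrices, and set $$X_{i,j}=T\Big(\big(\tilde X_{i-1+l,\;j+c_2-k}\big)_{1\le k\le c_2,\,1\le l\le c_1}\Big),\qquad Y_{i_1,i_2}=\sum_{i=i_1}^{i_1+m_1-1}\ \sum_{j=i_2}^{i_2+m_2-1}X_{i,j},$$ $$S=\max\{Y_{i_1,i_2}:\ 1\le i_1\le N_1-m_1+1,\ 1\le i_2\le N_2-m_2+1\}.$$ For real $n$ and $r,u,v\in\{2,3\}$ let $$Q_r=P\Big(\max_{1\le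 i_1\le L_1b_1,\ 1\le i_2\le (r-1)b_2}Y_{i_1,i_2}\le n\Big),\qquad Q_{uv}=P\Big(\max_{1\le i_1\le (u-1)b_1,\ 1\le i_2\le (v-1)b_2}Y_{i_1,i_2}\le n\Big).$$ \textbf{Constants.} For $0\le\alpha\le 0.1$ let $t_2(\alpha)$ be the smallest positive root of $\alpha t^3-t+1=0$ (for $\alpha>0$ the second of its three real roots in increasing order). For $l>t_2(\alpha)^3$ put $\eta=1+l\alpha$ and $$K(\alpha)=\frac{\frac{11-3\alpha}{(1-\alpha)^2}+2l(1+3\alpha)\frac{2+3l\alpha-\alpha(2-l\alpha)(1+l\alpha)^2}{[1-\alpha(1+l\alpha)^2]^3}}{1-\frac{2\alpha(1+l\alpha)}{[1-\alpha(1+l\alpha)^2]^2}},$$ $$L(\alpha)=3K(\alpha)(1+\alpha+3\alpha^2)\,[1+\alpha+3\alpha^2+K(\alpha)\alpha^3]+\alpha^6K(\alpha)^3+9\alpha(4+3\alpha+3\alpha^2)+55.1,$$ $$E(\alpha)=\frac{\eta^5[1+(1-2\alpha)\eta]^4[1+\alpha(\eta-2)][1+\eta+(1-3\alpha)\eta^2]}{2(1-\alpha\eta^2)^4\,[(1-\alpha\eta^2)^2-\alpha\eta^2(1+\eta-2\alpha\eta)^2]},\qquad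 \Gamma(\alpha)=L(\alpha)+E(\alpha),$$ where $l$ is also required to satisfy $1-\alpha\eta^2>0$, $\ 1-\frac{2\alpha\eta}{(1-\alpha\eta^2)^2}>0$ and $(1-\alpha\eta^2)^2-\alpha\eta^2(1+\eta-2\alpha\eta)^2>0$ (positive denominators). For an integer $m\ge1$ and $q\in[0,1]$ put $$F(\alpha,m;q)=1+\frac3m+\Big[\frac{\Gamma(\alpha)}m+K(\alpha)\Big](1-q),\qquad H(x,y,m)=\frac{2x-y}{[1+x-y+2(x-y)^2]^m}.$$ \textbf{Statement.} Let $n,\alpha_1,\alpha_2$ satisfy $Q_2\ge1-\alpha_1\ge0.9$ and $Q_{23}\ge1-\alpha_2\ge0.9$, and choose admissible $l_1$ for $\alpha_1$ and $l_2$ for $\alpha_2$ as above. Put $R_s=H(Q_{2s},Q_{3s},L_1)$ for $s\in\{2,3\}$, $F_2=F(\alpha_1,L_2;Q_2)$, $F_1=F(\alpha_2,L_1;Q_{23})$ and $B_2=1-R_2+L_1F_1(1-Q_{22})^2$. Then $$|P(S\le n)-H(R_2,R_3,L_2)|\le E_{app}=L_2F_2B_2^2+L_1L_2F_1\big[(1-Q_{22})^2+(1-Q_{23})^2\big].$$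 The bound also holds when, in $B_2$ and in the term with $(1-Q_{22})^2$, the factor $F_1=F(\alpha_2,L_1;Q_{23})$ is replaced by $F(\alpha_2,L_1;Q_{22})$. -/

import Mathlib

open MeasureTheory ProbabilityTheory

/-! Two-dimensional discrete scan statistic over a block-factor random field. -/

/-- The integer parameters of the model: the extents `x₁, x₂, y₁, y₂` of the block around a site,
the size `m₁ × m₂` of the scanning window, and the numbers `L₁, L₂` of blocks. -/
structure ScanParams where
  x₁ : ℕ
  x₂ : ℕ
  y₁ : ℕ
  y₂ : ℕ
  m₁ : ℕ
  m₂ : ℕ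
  L₁ : ℕ
  L₂ : ℕ

namespace ScanParams

/-- `c₁ = x₁ + x₂ + 1`, the number of columns of the configuration matrix. -/
abbrev c₁ (P : ScanParams) : ℕ := P.x₁ + P.x₂ + 1

/-- `c₂ = y₁ + y₂ + 1`, the number of rows of the configuration matrix. -/
abbrev c₂ (P : ScanParams) : ℕ := P.y₁ + P.y₂ + 1

/-- The horizontal block length `m₁ + c₁ - 2`. -/
def b₁ (P : ScanParams) : ℕ := P.m₁ + P.c₁ - 2

/-- The vertical block length `m₂ + c₂ - 2`. -/
def b₂ (P : ScanParams) : ℕ := P.m₂ + P.c₂ - 2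

/-- The horizontal size `Ñ₁ = (L₁ + 1)(m₁ + c₁ - 2)` of the underlying i.i.d. grid. -/
def Ntilde₁ (P : ScanParams) : ℕ := (P.L₁ + 1) * P.b₁

/-- The vertical size `Ñ₂ = (L₂ + 1)(m₂ + c₂ - 2)` of the underlying i.i.d. grid. -/
def Ntilde₂ (P : ScanParams) : ℕ := (P.L₂ + 1) * P.b₂

/-- `N₁ = Ñ₁ - c₁ + 1`, the horizontal size of the block-factor field. -/
def N₁ (P : ScanParams) : ℕ := P.Ntilde₁ - P.c₁ + 1

/-- `N₂ = Ñ₂ - c₂ + 1`, the vertical size of the block-factor field. -/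
def N₂ (P : ScanParams) : ℕ := P.Ntilde₂ - P.c₂ + 1

/-- The sites `(i, j)` at which the i.i.d. variables are given: `1 ≤ i ≤ Ñ₁`, `1 ≤ j ≤ Ñ₂`.
In a direction with `L = 1` the grid has three blocks instead of `L + 1 = 2`, since the
probabilities `Q₃`, `Q₂₃`, `Q₃₂`, `Q₃₃` refer to three consecutive blocks of variables. -/
def sites (P : ScanParams) : Finset (ℕ × ℕ) :=
  Finset.Icc 1 (max P.Ntilde₁ (3 * P.b₁)) ×ˢ Finset.Icc 1 (max P.Ntilde₂ (3 * P.b₂))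

/-- The configuration matrix `C_{(i,j)}(k,l) = X̃_{i-x₁-1+l, j+y₂+1-k}`, `1 ≤ k ≤ c₂`, `1 ≤ l ≤ c₁`
(here `k` and `l` are counted from `0`). -/
def configMatrix (P : ScanParams) (X : ℕ → ℕ → ℝ) (i j : ℕ) :
    Matrix (Fin P.c₂) (Fin P.c₁) ℝ :=
  fun k l => X (i - P.x₁ + l) (j + P.y₂ - k)

/-- The block-factor field `X_{i,j} = T (C_{(i+x₁,j+y₁)})`. -/
def blockFactor (P : ScanParams) (T : Matrix (Fin P.c₂) (Fin P.c₁) ℝ → ℝ) (X : ℕ → ℕ → ℝ)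
    (i j : ℕ) : ℝ :=
  T (P.configMatrix X (i + P.x₁) (j + P.y₁))

/-- The moving sum `Y_{i₁,i₂}` of the block-factor field over the `m₁ × m₂` window at `(i₁, i₂)`. -/
def windowSum (P : ScanParams) (T : Matrix (Fin P.c₂) (Fin P.c₁) ℝ → ℝ) (X : ℕ → ℕ → ℝ)
    (i₁ i₂ : ℕ) : ℝ :=
  ∑ i ∈ Finset.Ico i₁ (i₁ + P.m₁), ∑ j ∈ Finset.Ico i₂ (i₂ + P.m₂), P.blockFactor T X i j

/-- The maximum of `Y_{i₁,i₂}` over `1 ≤ i₁ ≤ a`, `1 ≤ i₂ ≤ b` (a finite set, nonempty for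
`a, b ≥ 1`). -/
noncomputable def maxWindow (P : ScanParams) (T : Matrix (Fin P.c₂) (Fin P.c₁) ℝ → ℝ)
    (X : ℕ → ℕ → ℝ) (a b : ℕ) : ℝ :=
  sSup ((fun p : ℕ × ℕ => P.windowSum T X p.1 p.2) '' (Set.Icc 1 a ×ˢ Set.Icc 1 b))

theorem maxWindow_le_iff (P : ScanParams) (T : Matrix (Fin P.c₂) (Fin P.c₁) ℝ → ℝ)
    (X : ℕ → ℕ → ℝ) {a b : ℕ} (ha : 1 ≤ a) (hb : 1 ≤ b) (n : ℝ) :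
    P.maxWindow T X a b ≤ n ↔
      ∀ i₁ ∈ Set.Icc 1 a, ∀ i₂ ∈ Set.Icc 1 b, P.windowSum T X i₁ i₂ ≤ n := by
  have hne : ((fun p : ℕ × ℕ => P.windowSum T X p.1 p.2) ''
      (Set.Icc 1 a ×ˢ Set.Icc 1 b)).Nonempty :=
    Set.Nonempty.image _ ⟨(1, 1), by simp [ha, hb]⟩
  have hbd : BddAbove ((fun p : ℕ × ℕ => P.windowSum T X p.1 p.2) ''
      (Set.Icc 1 a ×ˢ Set.Icc 1 b)) :=
    (((Set.finite_Icc 1 a).prod (Set.finite_Icc 1 b)).image _).bddAbove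
  unfold maxWindow
  rw [csSup_le_iff hbd hne]
  constructor
  · intro h i hi j hj
    exact h _ ⟨(i, j), ⟨hi, hj⟩, rfl⟩
  · rintro h _ ⟨⟨i, j⟩, ⟨hi, hj⟩, rfl⟩
    exact h i hi j hj

/-- The two-dimensional scan statistic
`S = max {Y_{i₁,i₂} : 1 ≤ i₁ ≤ N₁ - m₁ + 1, 1 ≤ i₂ ≤ N₂ - m₂ + 1}`. -/
noncomputable def scan (P : ScanParams) (T : Matrix (Fin P.c₂) (Fin P.c₁) ℝ → ℝ)
    (X : ℕ → ℕ → ℝ) : ℝ :=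
  P.maxWindow T X (P.N₁ - P.m₁ + 1) (P.N₂ - P.m₂ + 1)

theorem N₁_sub (P : ScanParams) (hm : 2 ≤ P.m₁) (hL : 1 ≤ P.L₁) :
    P.N₁ - P.m₁ + 1 = P.L₁ * P.b₁ := by
  have h : P.b₁ ≤ P.L₁ * P.b₁ := Nat.le_mul_of_pos_left _ hL
  unfold N₁ Ntilde₁
  rw [Nat.add_mul, one_mul]
  unfold b₁ c₁ at *
  omega

theorem N₂_sub (P : ScanParams) (hm : 2 ≤ P.m₂) (hL : 1 ≤ P.L₂) :
    P.N₂ - P.m₂ + 1 = P.L₂ * P.b₂ := by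
  have h : P.b₂ ≤ P.L₂ * P.b₂ := Nat.le_mul_of_pos_left _ hL
  unfold N₂ Ntilde₂
  rw [Nat.add_mul, one_mul]
  unfold b₂ c₂ at *
  omega

variable {Ω : Type*} [MeasurableSpace Ω]

/-- `P(S ≤ n)`. -/
noncomputable def probScan (P : ScanParams) (T : Matrix (Fin P.c₂) (Fin P.c₁) ℝ → ℝ)
    (μ : Measure Ω) (X : ℕ → ℕ → Ω → ℝ) (n : ℝ) : ℝ :=
  μ.real {ω | P.scan T (fun i j => X i j ω) ≤ n}

/-- `Q_r(n)`: the probability that `Y_{i₁,i₂} ≤ n` for all `1 ≤ i₁ ≤ L₁(m₁+c₁-2)` and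
`1 ≤ i₂ ≤ (r-1)(m₂+c₂-2)`. -/
noncomputable def Qstrip (P : ScanParams) (T : Matrix (Fin P.c₂) (Fin P.c₁) ℝ → ℝ)
    (μ : Measure Ω) (X : ℕ → ℕ → Ω → ℝ) (n : ℝ) (r : ℕ) : ℝ :=
  μ.real {ω | P.maxWindow T (fun i j => X i j ω) (P.L₁ * P.b₁) ((r - 1) * P.b₂) ≤ n}

/-- `Q_{uv}(n)`: the probability that `Y_{i₁,i₂} ≤ n` for all `1 ≤ i₁ ≤ (u-1)(m₁+c₁-2)` and
`1 ≤ i₂ ≤ (v-1)(m₂+c₂-2)`. -/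
noncomputable def Qblock (P : ScanParams) (T : Matrix (Fin P.c₂) (Fin P.c₁) ℝ → ℝ)
    (μ : Measure Ω) (X : ℕ → ℕ → Ω → ℝ) (n : ℝ) (u v : ℕ) : ℝ :=
  μ.real {ω | P.maxWindow T (fun i j => X i j ω) ((u - 1) * P.b₁) ((v - 1) * P.b₂) ≤ n}

end ScanParams

namespace ScanBound

/-- `H(x,y,m) = (2x - y) / [1 + x - y + 2(x-y)²]^m`. -/
noncomputable def H (x y : ℝ) (m : ℕ) : ℝ :=
  (2 * x - y) / (1 + x - y + 2 * (x - y) ^ 2) ^ m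

/-- `t₂(α)`, the smallest positive root of `α t³ - t + 1 = 0`. For `0 < α < 4/27` the equation has
three real roots, one negative and two positive, so this is the second one in increasing order. -/
noncomputable def t₂ (α : ℝ) : ℝ := sInf {t : ℝ | 0 < t ∧ α * t ^ 3 - t + 1 = 0}

/-- `η = 1 + l α`. -/
def η (α l : ℝ) : ℝ := 1 + l * α

/-- The admissible values `l` for a given `α`: `l > t₂(α)³`, and the quantities in the denominators
of `K` and `E` are positive. -/
structure Admissible (α l : ℝ) : Prop where
  lt : t₂ α ^ 3 < l
  pos₁ : 0 < 1 - α * η α l ^ 2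
  pos₂ : 0 < 1 - 2 * α * η α l / (1 - α * η α l ^ 2) ^ 2
  pos₃ : 0 < (1 - α * η α l ^ 2) ^ 2 - α * η α l ^ 2 * (1 + η α l - 2 * α * η α l) ^ 2

noncomputable def K (α l : ℝ) : ℝ :=
  ((11 - 3 * α) / (1 - α) ^ 2
    + 2 * l * (1 + 3 * α) * ((2 + 3 * l * α - α * (2 - l * α) * (1 + l * α) ^ 2)
        / (1 - α * (1 + l * α) ^ 2) ^ 3))
  / (1 - 2 * α * (1 + l * α) / (1 - α * (1 + l * α) ^ 2) ^ 2)

noncomputable def Lam (α l : ℝ) : ℝ :=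
  3 * K α l * (1 + α + 3 * α ^ 2) * (1 + α + 3 * α ^ 2 + K α l * α ^ 3) + α ^ 6 * K α l ^ 3
    + 9 * α * (4 + 3 * α + 3 * α ^ 2) + 55.1

noncomputable def E (α l : ℝ) : ℝ :=
  (η α l ^ 5 * (1 + (1 - 2 * α) * η α l) ^ 4 * (1 + α * (η α l - 2))
      * (1 + η α l + (1 - 3 * α) * η α l ^ 2))
  / (2 * (1 - α * η α l ^ 2) ^ 4
      * ((1 - α * η α l ^ 2) ^ 2 - α * η α l ^ 2 * (1 + η α l - 2 * α * η α l) ^ 2))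

/-- `Γ(α) = L(α) + E(α)`. -/
noncomputable def Gam (α l : ℝ) : ℝ := Lam α l + E α l

/-- `F(α,m) = 1 + 3/m + [Γ(α)/m + K(α)](1 - q₁)`. -/
noncomputable def F (α l : ℝ) (m : ℕ) (q₁ : ℝ) : ℝ :=
  1 + 3 / m + (Gam α l / m + K α l) * (1 - q₁)

/-- `E_app = L₂ F₂ B₂² + L₁ L₂ [f₂ (1-Q₂₂)² + f₃ (1-Q₂₃)²]` with
`B₂ = 1 - R₂ + L₁ f₂ (1-Q₂₂)²`; for `f₂ = f₃ = F₁` this is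
`L₂ F₂ B₂² + L₁ L₂ F₁ [(1-Q₂₂)² + (1-Q₂₃)²]`. -/
def appError (L₁ L₂ : ℕ) (F₂ f₂ f₃ R₂ Q₂₂ Q₂₃ : ℝ) : ℝ :=
  L₂ * F₂ * (1 - R₂ + L₁ * f₂ * (1 - Q₂₂) ^ 2) ^ 2
    + L₁ * L₂ * (f₂ * (1 - Q₂₂) ^ 2 + f₃ * (1 - Q₂₃) ^ 2)

end ScanBound

/-! Call a b₁ × b₂ block of window positions good if all its moving sums are at most n, and let
G(m,k) be the probability that an m × k rectangle of blocks is good. The sums started in a block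
read no sites beyond the next block, so the good blocks form a stationary one-dependent field; P(S ≤
n) = G(L₁,L₂), and all the Q's are values of G.

In one dimension let q(n) be the probability of n good blocks in a row, p = 1 - q(1), a = q(1) -
q(2), ρ(u) = 1/(1+u+2u²). Inclusion-exclusion for three consecutive failures after a good run gives
q(n+2) - q(n+3) in terms of q(n) and q(n+1), up to an error between 0 and the probability of
failures at the two ends of the triple. Hence q(n+1) = ρ(a) q(n) up to order p² for n ≥ 1. Since
ρ(a) ≤ 1 the errors merely add, and |q(m) - H(q(1),q(2),m)| ≤ m(p² + 6p³)
(`IsRunSeq.abs_sub_geomApprox_le`).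

In two dimensions this is applied to the rows of height 1 and 2, so that R₂ and R₃ approximate
G(L₁,1) and G(L₁,2) within E₂ and E₃. The column k ↦ G(L₁,k) is then compared with the geometric
sequence built from R₂, R₃ instead of its own first two terms
(`IsRunSeq.abs_sub_geomApprox_perturbed_le`); this needs R₃ ≤ R₂
(`IsRunSeq.geomApprox_le_geomApprox`). The constants K and Γ enter only through K ≥ 11 and Γ ≥ 88,
which leave room for every error term (`perturbation_budget`). -/

/-! ### Second-order expansion of the ratio ρ. -/

/-- The ratio `1 / (1 + u + 2u²)` in the product form `H(x,y,m) = (2x-y) ρ(x-y)^m`. -/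
noncomputable def scanRatio (u : ℝ) : ℝ := (1 + u + 2 * u ^ 2)⁻¹

theorem scanRatio_denom_pos (u : ℝ) : 0 < 1 + u + 2 * u ^ 2 := by nlinarith [sq_nonneg (1 + 4 * u)]

theorem scanRatio_pos (u : ℝ) : 0 < scanRatio u := inv_pos.2 (scanRatio_denom_pos u)

theorem scanRatio_le_one {u : ℝ} (hu : 0 ≤ u) : scanRatio u ≤ 1 :=
  inv_le_one_of_one_le₀ (by nlinarith)

theorem scanRatio_mul (u : ℝ) : scanRatio u * (1 + u + 2 * u ^ 2) = 1 :=
  inv_mul_cancel₀ (scanRatio_denom_pos u).ne'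

theorem H_eq_mul_scanRatio_pow (x y : ℝ) (m : ℕ) :
    ScanBound.H x y m = (2 * x - y) * scanRatio (x - y) ^ m := by
  rw [ScanBound.H, scanRatio, inv_pow, div_eq_mul_inv, add_sub_assoc]

/-- The first-order term of 1 - ρ(a) is a, the leading decay rate of q; the remaining a² offsets a
second-order term of the recursion for q. -/
theorem one_sub_scanRatio_sub (a : ℝ) :
    1 - scanRatio a - a = (a ^ 2 - 2 * a ^ 3) * scanRatio a := by
  have := scanRatio_mul a
  linear_combination (-1 + a) * this

theorem one_sub_scanRatio_sub_nonneg {a : ℝ} (h : a ≤ 1 / 2) : 0 ≤ 1 - scanRatio a - a := by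
  rw [one_sub_scanRatio_sub]
  exact mul_nonneg (by nlinarith [mul_nonneg (sq_nonneg a) (sub_nonneg.2 h)]) (scanRatio_pos a).le

theorem one_sub_scanRatio_sub_le {a : ℝ} (h0 : 0 ≤ a) (h : a ≤ 1 / 2) :
    1 - scanRatio a - a ≤ a ^ 2 := by
  rw [one_sub_scanRatio_sub]
  have h1 : 0 ≤ a ^ 2 - 2 * a ^ 3 := by nlinarith [mul_nonneg (sq_nonneg a) (sub_nonneg.2 h)]
  have h2 := mul_le_of_le_one_right h1 (scanRatio_le_one h0)
  have : 0 ≤ a ^ 3 := by positivity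
  linarith

theorem le_one_sub_scanRatio_sub {a : ℝ} (h0 : 0 ≤ a) (h : a ≤ 1 / 2) :
    a ^ 2 - 3 * a ^ 3 ≤ 1 - scanRatio a - a := by
  have h1 : 1 - a - a ^ 2 ≤ scanRatio a := by
    have := one_sub_scanRatio_sub_le h0 h; linarith
  rw [one_sub_scanRatio_sub]
  have h2 : 0 ≤ a ^ 2 - 2 * a ^ 3 := by nlinarith [mul_nonneg (sq_nonneg a) (sub_nonneg.2 h)]
  have h3 := mul_le_mul_of_nonneg_left h1 h2
  have h4 : 0 ≤ a ^ 4 := by positivity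
  have h5 : 0 ≤ a ^ 5 := by positivity
  nlinarith

/-! ### One-dependent run sequences and the defect of the geometric recursion. -/

/-- The properties of the probabilities `q n = P(A₁ ∩ ⋯ ∩ Aₙ)` of a stationary one-dependent
sequence of events that the approximation of `q n` by a geometric sequence uses. -/
structure IsRunSeq (q : ℕ → ℝ) : Prop where
  zero : q 0 = 1
  nonneg : ∀ n, 0 ≤ q n
  anti : ∀ n, q (n + 1) ≤ q n
  convex : ∀ n, q (n + 1) - q (n + 2) ≤ q n - q (n + 1)
  three_le : q 3 ≤ q 1 ^ 2
  lower : ∀ n, (1 - q 1) * q (n + 1) - (1 - 2 * q 1 + q 2) * q n ≤ q (n + 2) - q (n + 3)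
  upper : ∀ n, q (n + 2) - q (n + 3) ≤ (1 - q 1) * q (n + 1) - (1 - 2 * q 1 + q 2) * q n
    + (1 - q 1) * (q n - q (n + 1))
  gap : ∀ n, q (n + 2) - q (n + 3) ≤ (q 1 - q 2) * q n

namespace IsRunSeq

variable {q : ℕ → ℝ}

theorem le_one (hq : IsRunSeq q) (n : ℕ) : q n ≤ 1 := by
  induction n with
  | zero => exact hq.zero.le
  | succ n ih => exact (hq.anti n).trans ih

theorem antitone (hq : IsRunSeq q) : Antitone q := antitone_nat_of_succ_le hq.anti

theorem diff_nonneg (hq : IsRunSeq q) : 0 ≤ q 1 - q 2 := sub_nonneg.2 (hq.anti 1)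

theorem diff_le (hq : IsRunSeq q) : q 1 - q 2 ≤ 1 - q 1 := by
  simpa [hq.zero] using hq.convex 0

theorem sub_succ_le_diff (hq : IsRunSeq q) (n : ℕ) : q (n + 1) - q (n + 2) ≤ q 1 - q 2 := by
  induction n with
  | zero => exact le_rfl
  | succ n ih => exact (hq.convex (n + 1)).trans ih

/-- Blocks 1 and 3 are independent, so q(1) - q(3) ≥ q(1)(1 - q(1)), while it consists of two
decrements of at most a each. So a cannot be much smaller than p/2. -/
theorem mul_le_two_mul_diff (hq : IsRunSeq q) : (1 - q 1) * q 1 ≤ 2 * (q 1 - q 2) := by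
  have := hq.three_le
  have := hq.sub_succ_le_diff 1
  norm_num at this
  nlinarith

/-- The defect of `q` at `n + 1` as a solution of the geometric recursion with ratio
`scanRatio (q 1 - q 2)`. -/
noncomputable def _root_.recursionDefect (q : ℕ → ℝ) (n : ℕ) : ℝ :=
  q (n + 1) - scanRatio (q 1 - q 2) * q n

theorem recursionDefect_one_le (hq : IsRunSeq q) (hp : 1 - q 1 ≤ 0.1) :
    recursionDefect q 1 ≤ 0 := by
  have h0 := hq.diff_nonneg
  have h1 := hq.diff_le
  have h2 := one_sub_scanRatio_sub_le h0 (by linarith)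
  have h3 := one_sub_scanRatio_sub_nonneg (a := q 1 - q 2) (by linarith)
  have h4 := mul_le_of_le_one_left h3 (hq.le_one 1)
  unfold recursionDefect
  nlinarith

theorem le_recursionDefect_one (hq : IsRunSeq q) (hp : 1 - q 1 ≤ 0.1) :
    -((q 1 - q 2) * (1 - q 1)) ≤ recursionDefect q 1 := by
  have h1 := hq.diff_le
  have h3 := one_sub_scanRatio_sub_nonneg (a := q 1 - q 2) (by linarith)
  have h4 := mul_nonneg (hq.nonneg 1) h3
  unfold recursionDefect
  nlinarith

/-- The defect at `n + 3` through the increments of `q`, up to the probability of three consecutive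
failures. -/
theorem recursionDefect_le (hq : IsRunSeq q) (n : ℕ) :
    recursionDefect q (n + 2) ≤ q (n + 2) * (1 - scanRatio (q 1 - q 2) - (q 1 - q 2))
      - (q 1 - q 2) * (q (n + 1) - q (n + 2))
      + (1 - 2 * q 1 + q 2) * (q n - q (n + 1)) := by
  have := hq.lower n
  unfold recursionDefect
  norm_num [add_assoc]
  nlinarith

/-- Here three consecutive failures are bounded by failures at the first and third place, which are
independent. -/
theorem le_recursionDefect (hq : IsRunSeq q) (n : ℕ) :
    q (n + 2) * (1 - scanRatio (q 1 - q 2) - (q 1 - q 2))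
      - (q 1 - q 2) * (q (n + 1) - q (n + 2)) - (q 1 - q 2) * (q n - q (n + 1))
      ≤ recursionDefect q (n + 2) := by
  have := hq.upper n
  unfold recursionDefect
  norm_num [add_assoc]
  nlinarith

theorem recursionDefect_two_le (hq : IsRunSeq q) (hp : 1 - q 1 ≤ 0.1) :
    recursionDefect q 2 ≤ (1 - q 1) * (1 - 2 * q 1 + q 2) := by
  have h0 := hq.diff_nonneg
  have h1 := hq.diff_le
  have h2 := one_sub_scanRatio_sub_le h0 (by linarith)
  have h3 := one_sub_scanRatio_sub_nonneg (a := q 1 - q 2) (by linarith)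
  have h4 := mul_le_of_le_one_left h3 (hq.le_one 2)
  have h5 := hq.recursionDefect_le 0
  norm_num [hq.zero] at h5
  nlinarith

theorem le_recursionDefect_two (hq : IsRunSeq q) (hp : 1 - q 1 ≤ 0.1) :
    -((q 1 - q 2) ^ 2 + (q 1 - q 2) * (1 - q 1)) ≤ recursionDefect q 2 := by
  have h0 := hq.diff_nonneg
  have h1 := hq.diff_le
  have h3 := one_sub_scanRatio_sub_nonneg (a := q 1 - q 2) (by linarith)
  have h4 := mul_nonneg (hq.nonneg 2) h3
  have h5 := hq.le_recursionDefect 0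
  norm_num [hq.zero] at h5
  nlinarith [mul_le_mul_of_nonneg_left h1 h0]

theorem recursionDefect_add_three_le (hq : IsRunSeq q) (hp : 1 - q 1 ≤ 0.1) (n : ℕ) :
    recursionDefect q (n + 3) ≤ (1 - q 1) * (q 1 - q 2) := by
  have h0 := hq.diff_nonneg
  have h1 := hq.diff_le
  have h2 := one_sub_scanRatio_sub_le h0 (by linarith)
  have h3 := one_sub_scanRatio_sub_nonneg (a := q 1 - q 2) (by linarith)
  have h4 := mul_le_of_le_one_left h3 (hq.le_one (n + 3))
  have h5 := hq.recursionDefect_le (n + 1)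
  have h6 : 0 ≤ q (n + 2) - q (n + 3) := sub_nonneg.2 (hq.anti _)
  have h7 := hq.sub_succ_le_diff n
  have h8 : (1 - 2 * q 1 + q 2) * (q (n + 1) - q (n + 2))
      ≤ (1 - 2 * q 1 + q 2) * (q 1 - q 2) :=
    mul_le_mul_of_nonneg_left h7 (by linarith)
  have h9 := mul_nonneg h0 h6
  have e : n + 1 + 2 = n + 3 := rfl
  have e' : n + 1 + 1 = n + 2 := rfl
  rw [e, e'] at h5
  nlinarith

theorem le_recursionDefect_add_three (hq : IsRunSeq q) (hp : 1 - q 1 ≤ 0.1) (n : ℕ) :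
    -(2 * (q 1 - q 2) ^ 2) ≤ recursionDefect q (n + 3) := by
  have h0 := hq.diff_nonneg
  have h1 := hq.diff_le
  have h3 := one_sub_scanRatio_sub_nonneg (a := q 1 - q 2) (by linarith)
  have h4 := mul_nonneg (hq.nonneg (n + 3)) h3
  have h5 : _ ≤ recursionDefect q (n + 3) := hq.le_recursionDefect (n + 1)
  have h6 := mul_le_mul_of_nonneg_left (hq.sub_succ_le_diff n) h0
  have h7 := mul_le_mul_of_nonneg_left (hq.sub_succ_le_diff (n + 1)) h0
  have e : n + 1 + 2 = n + 3 := rfl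
  have e' : n + 1 + 1 = n + 2 := rfl
  rw [e, e'] at h5 h7
  nlinarith

/-- Two decrements contribute -a² each to the defect, and the a² in 1 - ρ(a) cancels one of them.
This lowers the coefficient of the second-order term from 2 to 1, at a cubic cost. -/
theorem le_recursionDefect_add_three' (hq : IsRunSeq q) (hp : 1 - q 1 ≤ 0.1) (n : ℕ) :
    -((1 - q 1) ^ 2 + 6 * (1 - q 1) ^ 3) ≤ recursionDefect q (n + 3) := by
  have h0 := hq.diff_nonneg
  have h1 := hq.diff_le
  have h3 := le_one_sub_scanRatio_sub h0 (by linarith)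
  have h4 := mul_le_mul_of_nonneg_left h3 (hq.nonneg (n + 3))
  have h5 : _ ≤ recursionDefect q (n + 3) := hq.le_recursionDefect (n + 1)
  have e : n + 1 + 2 = n + 3 := rfl
  have e' : n + 1 + 1 = n + 2 := rfl
  rw [e, e'] at h5
  have h6 := mul_le_mul_of_nonneg_left (hq.sub_succ_le_diff n) h0
  have h7 := mul_le_mul_of_nonneg_left (hq.gap n) h0
  have d1 := hq.sub_succ_le_diff n
  have d2 := hq.sub_succ_le_diff (n + 1)
  rw [e, e'] at d2
  have d3 : q n - q (n + 1) ≤ 1 - q 1 := by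
    rcases n with _ | n
    · simp [hq.zero]
    · exact (hq.sub_succ_le_diff n).trans h1
  generalize q 1 - q 2 = a at *
  generalize 1 - q 1 = p at *
  have hu := hq.le_one (n + 3)
  have hu0 := hq.nonneg (n + 3)
  -- Three decrements of at most p lead from q(n) to q(n+3), so that the `gap` bound a q(n) can be
  -- cancelled against the a² q(n+3) coming from ρ.
  have h8 : a * (a * q n) ≤ a * (a * (q (n + 3) + 3 * p)) :=
    mul_le_mul_of_nonneg_left (mul_le_mul_of_nonneg_left (by linarith) h0) h0
  have h9 : q (n + 3) * a ^ 3 ≤ a ^ 3 := mul_le_of_le_one_left (by positivity) hu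
  have h10 : a ^ 2 ≤ p ^ 2 := by gcongr
  have h11 : a ^ 3 ≤ p ^ 3 := by gcongr
  have h12 : a ^ 2 * p ≤ p ^ 3 := by nlinarith
  nlinarith

/-! ### Error of the geometric approximation in one dimension. -/

/-- The geometric approximation of `q`. -/
noncomputable def _root_.geomApprox (x u : ℝ) (n : ℕ) : ℝ := (x + u) * scanRatio u ^ n

theorem _root_.H_eq_geomApprox (x y : ℝ) (n : ℕ) :
    ScanBound.H x y n = geomApprox x (x - y) n := by
  rw [H_eq_mul_scanRatio_pow, geomApprox]; ring

theorem sub_geomApprox_succ (q : ℕ → ℝ) (n : ℕ) :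
    q (n + 1) - geomApprox (q 1) (q 1 - q 2) (n + 1) = recursionDefect q n
      + scanRatio (q 1 - q 2) * (q n - geomApprox (q 1) (q 1 - q 2) n) := by
  unfold recursionDefect geomApprox
  ring

/-- The prefactor q(1) + a removes the first-order error at index 1. The induction starts here and
not at 0, where the defect is still of first order. -/
theorem sub_geomApprox_one (q : ℕ → ℝ) :
    q 1 - geomApprox (q 1) (q 1 - q 2) 1 =
      (2 * q 1 - q 2) * (1 - scanRatio (q 1 - q 2) - (q 1 - q 2))
        - (q 1 - q 2) * (1 - 2 * q 1 + q 2) := by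
  unfold geomApprox
  ring

/-- One step of an upper bound for `q n - geomApprox`. -/
theorem sub_geomApprox_succ_le (hq : IsRunSeq q) {n : ℕ} {c e : ℝ} (he : 0 ≤ e)
    (hc : recursionDefect q n ≤ c) (h : q n - geomApprox (q 1) (q 1 - q 2) n ≤ e) :
    q (n + 1) - geomApprox (q 1) (q 1 - q 2) (n + 1) ≤ e + c := by
  rw [sub_geomApprox_succ]
  have h1 := mul_le_mul_of_nonneg_left h (scanRatio_pos (q 1 - q 2)).le
  have h2 := mul_le_of_le_one_left he (scanRatio_le_one hq.diff_nonneg)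
  linarith

theorem geomApprox_succ_sub_le (hq : IsRunSeq q) {n : ℕ} {c e : ℝ} (he : 0 ≤ e)
    (hc : -c ≤ recursionDefect q n) (h : geomApprox (q 1) (q 1 - q 2) n - q n ≤ e) :
    geomApprox (q 1) (q 1 - q 2) (n + 1) - q (n + 1) ≤ e + c := by
  have h0 := sub_geomApprox_succ q n
  have h1 := mul_le_mul_of_nonneg_left h (scanRatio_pos (q 1 - q 2)).le
  have h2 := mul_le_of_le_one_left he (scanRatio_le_one hq.diff_nonneg)
  linarith

theorem sub_geomApprox_one_le (hq : IsRunSeq q) (hp : 1 - q 1 ≤ 0.1) :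
    q 1 - geomApprox (q 1) (q 1 - q 2) 1 ≤ (q 1 - q 2) ^ 2 := by
  have h0 := hq.diff_nonneg
  have h1 := hq.diff_le
  have h2 := one_sub_scanRatio_sub_le h0 (by linarith)
  have h3 := one_sub_scanRatio_sub_nonneg (a := q 1 - q 2) (by linarith)
  rw [sub_geomApprox_one]
  have h4 := mul_le_of_le_one_left h3 (show 2 * q 1 - q 2 ≤ 1 by linarith)
  have h5 := mul_nonneg h0 (show 0 ≤ 1 - 2 * q 1 + q 2 by linarith)
  linarith

theorem sub_geomApprox_two_le (hq : IsRunSeq q) (hp : 1 - q 1 ≤ 0.1) :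
    q 2 - geomApprox (q 1) (q 1 - q 2) 2 ≤ (q 1 - q 2) ^ 2 := by
  simpa using hq.sub_geomApprox_succ_le (sq_nonneg _) (hq.recursionDefect_one_le hp)
    (hq.sub_geomApprox_one_le hp)

/-- The growth in n keeps a factor a, because the ordering of R₂ and R₃ compares it with a lower
bound for 1 - q(n+3) whose growth per step is 0.8 a. -/
theorem sub_geomApprox_add_three_le (hq : IsRunSeq q) (hp : 1 - q 1 ≤ 0.1) (n : ℕ) :
    q (n + 3) - geomApprox (q 1) (q 1 - q 2) (n + 3)
      ≤ (1 - q 1) ^ 2 + n * ((1 - q 1) * (q 1 - q 2)) := by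
  have h0 := hq.diff_nonneg
  have h1 := hq.diff_le
  induction n with
  | zero =>
    have := hq.sub_geomApprox_succ_le (sq_nonneg _) (hq.recursionDefect_two_le hp)
      (hq.sub_geomApprox_two_le hp)
    norm_num at this ⊢
    nlinarith [mul_le_mul_of_nonneg_left h1 h0]
  | succ n ih =>
    have := hq.sub_geomApprox_succ_le (add_nonneg (sq_nonneg _) (mul_nonneg n.cast_nonneg
      (mul_nonneg (h0.trans h1) h0))) (hq.recursionDefect_add_three_le hp n) ih
    push_cast
    have e : n + 1 + 3 = n + 3 + 1 := rfl
    rw [e]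
    linarith

theorem geomApprox_one_sub_le (hq : IsRunSeq q) (hp : 1 - q 1 ≤ 0.1) :
    geomApprox (q 1) (q 1 - q 2) 1 - q 1 ≤ (1 - 2 * q 1 + q 2) * (q 1 - q 2) := by
  have h1 := hq.diff_le
  have h3 := one_sub_scanRatio_sub_nonneg (a := q 1 - q 2) (by linarith)
  have h0 := sub_geomApprox_one q
  have h4 := mul_nonneg (show 0 ≤ 2 * q 1 - q 2 by linarith [hq.diff_nonneg]) h3
  linarith

theorem geomApprox_two_sub_le (hq : IsRunSeq q) (hp : 1 - q 1 ≤ 0.1) :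
    geomApprox (q 1) (q 1 - q 2) 2 - q 2
      ≤ (1 - 2 * q 1 + q 2) * (q 1 - q 2) + (q 1 - q 2) * (1 - q 1) :=
  hq.geomApprox_succ_sub_le (mul_nonneg (by linarith [hq.diff_le]) hq.diff_nonneg)
    (hq.le_recursionDefect_one hp) (hq.geomApprox_one_sub_le hp)

theorem geomApprox_three_sub_le (hq : IsRunSeq q) (hp : 1 - q 1 ≤ 0.1) :
    geomApprox (q 1) (q 1 - q 2) 3 - q 3
      ≤ 3 * ((q 1 - q 2) * (1 - q 1)) := by
  have h0 := hq.diff_nonneg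
  have h1 := hq.diff_le
  have := hq.geomApprox_succ_sub_le (add_nonneg (mul_nonneg (by linarith) h0)
    (mul_nonneg h0 (by linarith))) (hq.le_recursionDefect_two hp) (hq.geomApprox_two_sub_le hp)
  norm_num at this ⊢
  linarith

end IsRunSeq

namespace IsRunSeq

variable {q : ℕ → ℝ}

theorem geomApprox_add_three_sub_le (hq : IsRunSeq q) (hp : 1 - q 1 ≤ 0.1) (n : ℕ) :
    geomApprox (q 1) (q 1 - q 2) (n + 3) - q (n + 3)
      ≤ 3 * ((q 1 - q 2) * (1 - q 1)) + n * (2 * (q 1 - q 2) ^ 2) := by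
  have h0 := hq.diff_nonneg
  have h1 := hq.diff_le
  induction n with
  | zero => simpa using hq.geomApprox_three_sub_le hp
  | succ n ih =>
    have := hq.geomApprox_succ_sub_le (add_nonneg (mul_nonneg zero_le_three
      (mul_nonneg h0 (h0.trans h1))) (mul_nonneg n.cast_nonneg (by positivity)))
      (hq.le_recursionDefect_add_three hp n) ih
    push_cast
    have e : n + 1 + 3 = n + 3 + 1 := rfl
    rw [e]
    linarith

theorem abs_recursionDefect_one_le (hq : IsRunSeq q) (hp : 1 - q 1 ≤ 0.1) :
    |recursionDefect q 1| ≤ (1 - q 1) ^ 2 := by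
  have h0 := hq.diff_nonneg
  have h1 := hq.diff_le
  have := hq.recursionDefect_one_le hp
  have := hq.le_recursionDefect_one hp
  rw [abs_le]
  constructor <;> nlinarith

theorem abs_recursionDefect_two_le (hq : IsRunSeq q) (hp : 1 - q 1 ≤ 0.1) :
    |recursionDefect q 2| ≤ 2 * (1 - q 1) ^ 2 := by
  have h0 := hq.diff_nonneg
  have h1 := hq.diff_le
  have := hq.recursionDefect_two_le hp
  have := hq.le_recursionDefect_two hp
  rw [abs_le]
  constructor <;> nlinarith

theorem abs_recursionDefect_add_three_le (hq : IsRunSeq q) (hp : 1 - q 1 ≤ 0.1) (n : ℕ) :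
    |recursionDefect q (n + 3)| ≤ (1 - q 1) ^ 2 + 6 * (1 - q 1) ^ 3 := by
  have h0 := hq.diff_nonneg
  have h1 := hq.diff_le
  have h2 := hq.recursionDefect_add_three_le hp n
  have h3 := hq.le_recursionDefect_add_three' hp n
  have h4 : 0 ≤ (1 - q 1) ^ 3 := pow_nonneg (h0.trans h1) 3
  rw [abs_le]
  constructor <;> nlinarith

/-- The defect at 2 is only bounded by 2p², which accounts for the extra 1 in n + 1. -/
theorem sum_abs_recursionDefect_le (hq : IsRunSeq q) (hp : 1 - q 1 ≤ 0.1) (n : ℕ) :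
    ∑ i ∈ Finset.range n, |recursionDefect q (i + 1)|
      ≤ (n + 1) * ((1 - q 1) ^ 2 + 6 * (1 - q 1) ^ 3) := by
  have h3 : 0 ≤ (1 - q 1) ^ 3 := pow_nonneg (hq.diff_nonneg.trans hq.diff_le) 3
  have h2 := sq_nonneg (1 - q 1)
  have h4 := hq.abs_recursionDefect_one_le hp
  have h5 := hq.abs_recursionDefect_two_le hp
  match n with
  | 0 => norm_num; linarith
  | 1 => norm_num; linarith
  | n + 2 =>
    induction n with
    | zero => norm_num [Finset.sum_range_succ]; linarith
    | succ n ih =>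
      rw [Finset.sum_range_succ]
      have := hq.abs_recursionDefect_add_three_le hp n
      have e : n + 2 + 1 = n + 3 := rfl
      rw [e]
      push_cast at ih ⊢
      linarith

theorem abs_sub_geomApprox_succ_le (hq : IsRunSeq q) (n : ℕ) :
    |q (n + 1) - geomApprox (q 1) (q 1 - q 2) (n + 1)| ≤ |recursionDefect q n|
      + |q n - geomApprox (q 1) (q 1 - q 2) n| := by
  rw [sub_geomApprox_succ]
  refine (abs_add_le _ _).trans (add_le_add le_rfl ?_)
  rw [abs_mul, abs_of_pos (scanRatio_pos _)]
  exact mul_le_of_le_one_left (abs_nonneg _) (scanRatio_le_one hq.diff_nonneg)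

/-- The one-dimensional approximation: `q m` is close to `H (q 1) (q 2) m`. -/
theorem abs_sub_geomApprox_le (hq : IsRunSeq q) (hp : 1 - q 1 ≤ 0.1) {m : ℕ} (hm : 1 ≤ m) :
    |q m - geomApprox (q 1) (q 1 - q 2) m| ≤ m * ((1 - q 1) ^ 2 + 6 * (1 - q 1) ^ 3) := by
  have h0 := hq.diff_nonneg
  have h1 := hq.diff_le
  have h3 : 0 ≤ (1 - q 1) ^ 3 := pow_nonneg (h0.trans h1) 3
  have e1 : |q 1 - geomApprox (q 1) (q 1 - q 2) 1| ≤ (1 - q 1) ^ 2 := by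
    have h4 := hq.sub_geomApprox_one_le hp
    have h5 := hq.geomApprox_one_sub_le hp
    rw [abs_le]
    constructor <;> nlinarith
  have e2 : |q 2 - geomApprox (q 1) (q 1 - q 2) 2| ≤ 2 * (1 - q 1) ^ 2 := by
    have := hq.abs_sub_geomApprox_succ_le 1
    have := hq.abs_recursionDefect_one_le hp
    norm_num at *
    linarith
  have e3 : |q 3 - geomApprox (q 1) (q 1 - q 2) 3| ≤ 3 * (1 - q 1) ^ 2 := by
    have h4 := hq.sub_geomApprox_add_three_le hp 0
    have h5 := hq.geomApprox_three_sub_le hp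
    norm_num at h4 h5
    rw [abs_le]
    constructor <;> nlinarith
  match m, hm with
  | 1, _ => norm_num; linarith
  | 2, _ => norm_num; linarith
  | n + 3, _ =>
    induction n with
    | zero => norm_num; linarith
    | succ n ih =>
      have h4 := hq.abs_sub_geomApprox_succ_le (n + 3)
      have h5 := hq.abs_recursionDefect_add_three_le hp n
      have e : n + 1 + 3 = n + 3 + 1 := rfl
      rw [e]
      have h6 := ih (by omega)
      push_cast at h6 ⊢
      linarith

/-! ### Failure probabilities from below, and the ordering of two approximations. -/

theorem le_one_sub_add_three (hq : IsRunSeq q) (n : ℕ) (hn : 0.9 ≤ q (n + 3)) :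
    (1 - q 1) + 2 * (q 1 - q 2) - (1 - q 1) ^ 2 + n * (0.8 * (q 1 - q 2)) ≤ 1 - q (n + 3) := by
  have h0 := hq.diff_nonneg
  induction n with
  | zero =>
    have := hq.lower 0
    norm_num [hq.zero] at *
    nlinarith
  | succ n ih =>
    have e : n + 1 + 3 = n + 3 + 1 := rfl
    rw [e] at *
    have h1 : 0.9 ≤ q (n + 3) := hn.trans (hq.anti _)
    have h2 := ih h1
    have h3 : q (n + 3) - q (n + 4) ≥ _ := hq.lower (n + 1)
    have h4 := mul_le_mul_of_nonneg_left (hq.sub_succ_le_diff n)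
      (show 0 ≤ 1 - 2 * q 1 + q 2 by linarith [hq.diff_le])
    have h5 : q (n + 3) ≤ q (n + 2) := hq.anti _
    have h6 : 0.9 ≤ q 1 := h1.trans (hq.antitone (by omega))
    have e1 : n + 1 + 1 = n + 2 := rfl
    rw [e1] at h3
    -- Each decrement is at least a q(n+2) - (p - a) a ≥ 0.9 a - 0.1 a.
    have h7 := mul_le_mul_of_nonneg_left (h1.trans h5) h0
    have h8 : (1 - 2 * q 1 + q 2) * (q 1 - q 2) ≤ 0.1 * (q 1 - q 2) :=
      mul_le_mul_of_nonneg_right (by linarith) h0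
    push_cast
    rw [show n + 3 + 1 = n + 4 from rfl]
    nlinarith

theorem diff_ge (hq : IsRunSeq q) (hp : 0.9 ≤ q 1) : 0.45 * (1 - q 1) ≤ q 1 - q 2 := by
  have := hq.mul_le_two_mul_diff
  nlinarith [hq.le_one 1]

/-- With q(m) ≥ 0.9 this bounds m p by about 1/3, which makes the accumulated error m(p² + 6p³) of
order p. -/
theorem mul_le_one_sub (hq : IsRunSeq q) {m : ℕ} (hm : 1 ≤ m) (hn : 0.9 ≤ q m) :
    0.3 * (m + 2) * (1 - q 1) ≤ 1 - q m := by
  have h1 : 0.9 ≤ q 1 := hn.trans (hq.antitone hm)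
  have h2 := hq.diff_ge h1
  have h3 := hq.le_one 1
  match m, hm with
  | 1, _ => norm_num; nlinarith
  | 2, _ => norm_num; nlinarith
  | n + 3, _ =>
    have h4 := hq.le_one_sub_add_three n hn
    have h5 : (n : ℝ) * (0.8 * (0.45 * (1 - q 1))) ≤ n * (0.8 * (q 1 - q 2)) := by gcongr
    have h6 : 0 ≤ (n : ℝ) * (1 - q 1) := mul_nonneg n.cast_nonneg (by linarith)
    push_cast
    nlinarith

/-- Two run sequences, for strips of one and of two rows: the approximations of their terms are
ordered like the terms themselves. -/
theorem geomApprox_le_geomApprox {r : ℕ → ℝ} (hq : IsRunSeq q) (hr : IsRunSeq r) {m : ℕ}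
    (hm : 1 ≤ m) (hqm : 0.9 ≤ q m) (hr1 : 0.9 ≤ r 1) (hgap : 0.45 * (1 - q m) ≤ q m - r m)
    (hp : 1 - r 1 ≤ 2 * (1 - q 1)) (ha : r 1 - r 2 ≤ 2 * (q 1 - q 2)) :
    geomApprox (r 1) (r 1 - r 2) m ≤ geomApprox (q 1) (q 1 - q 2) m := by
  have hq1 : 0.9 ≤ q 1 := hqm.trans (hq.antitone hm)
  have a0 := hq.diff_nonneg
  have a1 := hq.diff_le
  have b0 := hr.diff_nonneg
  have b1 := hr.diff_le
  have hq1' : 1 - q 1 ≤ 0.1 := by linarith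
  have hr1' : 1 - r 1 ≤ 0.1 := by linarith
  match m, hm with
  | 1, _ =>
    have h1 := hq.sub_geomApprox_one_le hq1'
    have h2 := hr.geomApprox_one_sub_le hr1'
    nlinarith
  | 2, _ =>
    have h1 := hq.sub_geomApprox_two_le hq1'
    have h2 := hr.geomApprox_two_sub_le hr1'
    have h3 : (1 - 2 * r 1 + r 2) * (r 1 - r 2) + (r 1 - r 2) * (1 - r 1) ≤ (1 - r 1) ^ 2 := by
      nlinarith [sq_nonneg (1 - 2 * r 1 + r 2)]
    nlinarith
  | 3, _ =>
    have h1 := hq.sub_geomApprox_add_three_le hq1' 0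
    have h2 := hr.geomApprox_three_sub_le hr1'
    have h3 := hq.le_one_sub_add_three 0 hqm
    norm_num at h1 h3
    nlinarith
  | n + 4, _ =>
    have h1 := hq.sub_geomApprox_add_three_le hq1' (n + 1)
    have h2 := hr.geomApprox_add_three_sub_le hr1' (n + 1)
    have h3 := hq.le_one_sub_add_three (n + 1) hqm
    have e : n + 1 + 3 = n + 4 := rfl
    rw [e] at h1 h2 h3
    generalize q 1 - q 2 = a at *
    generalize r 1 - r 2 = b at *
    have hn : (0 : ℝ) ≤ n := n.cast_nonneg
    push_cast at h1 h2 h3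
    have h4 : (1 - q 1) - (1 - q 1) ^ 2 + 2.8 * a ≤ 0.1 := by
      have := mul_nonneg hn a0
      linarith
    have h5 : 1 - q 1 + 8 * a ≤ 0.36 := by nlinarith
    -- The two errors together grow by p a + 2b² per step, where b ≤ 2a; the gap between the terms
    -- grows by 0.45 · 0.8 a = 0.36 a.
    have h6 : (1 - q 1) * a + 2 * b ^ 2 ≤ 0.36 * a := by nlinarith
    have h7 := mul_le_mul_of_nonneg_left h6 (show 0 ≤ (n : ℝ) + 1 by linarith)
    have h8 : 3 * (b * (1 - r 1)) ≤ 0.6 * a := by nlinarith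
    nlinarith

end IsRunSeq

/-! ### Stability of the approximation under a change of its two parameters. -/

theorem one_add_mul_one_add_le_denom (A : ℝ) {u : ℝ} (hu : 0 ≤ u) :
    (1 + A) * (1 + u) ≤ (1 + A + 2 * A ^ 2) * (1 + u + 2 * u ^ 2) :=
  mul_le_mul (by nlinarith [sq_nonneg A]) (by nlinarith [sq_nonneg u]) (by linarith)
    (scanRatio_denom_pos A).le

theorem mul_abs_scanRatio_sub_le {A u c k : ℝ} (hA : 0 ≤ A) (hu : 0 ≤ u)
    (h : c * (1 + 2 * u + 2 * A) ≤ k * ((1 + A + 2 * A ^ 2) * (1 + u + 2 * u ^ 2))) :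
    |scanRatio A - scanRatio u| * c ≤ |u - A| * k := by
  have hA' := scanRatio_denom_pos A
  have hu' := scanRatio_denom_pos u
  have e : scanRatio A - scanRatio u
      = (u - A) * ((1 + 2 * u + 2 * A) / ((1 + A + 2 * A ^ 2) * (1 + u + 2 * u ^ 2))) := by
    unfold scanRatio
    field_simp
    ring
  rw [e, abs_mul, mul_assoc]
  refine mul_le_mul_of_nonneg_left ?_ (abs_nonneg _)
  have h0 : 0 ≤ 1 + 2 * u + 2 * A :=
    add_nonneg (add_nonneg zero_le_one (mul_nonneg zero_le_two hu)) (mul_nonneg zero_le_two hA)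
  rw [abs_of_nonneg (by positivity), div_mul_eq_mul_div, div_le_iff₀ (by positivity)]
  linarith

theorem abs_sub_geomApprox_one_le {q₁ x u e v A B : ℝ} (hx0 : 0 ≤ x) (hx1 : x ≤ 1) (hu : 0 ≤ u)
    (hxe : |x - q₁| ≤ e) (huv : |u - A| ≤ v) (hA : A ≤ 1 - q₁) (hB : 1 - q₁ ≤ B)
    (hB' : 1 - x ≤ B) :
    |q₁ - geomApprox x u 1| ≤ e + 3 * B ^ 2 + 6 * v ^ 2 := by
  have hv : 0 ≤ v := (abs_nonneg _).trans huv
  have huB : u ≤ B + v := by linarith [(abs_le.1 huv).2]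
  have e1 : geomApprox x u 1 - x = u * (1 - x - 2 * x * u) * scanRatio u := by
    have := scanRatio_mul u
    unfold geomApprox
    linear_combination x * this
  have h1 : |geomApprox x u 1 - x| ≤ 3 * B ^ 2 + 6 * v ^ 2 := by
    rw [e1, abs_mul, abs_of_pos (scanRatio_pos u)]
    refine (mul_le_of_le_one_right (abs_nonneg _) (scanRatio_le_one hu)).trans ?_
    have hB0 : 0 ≤ B := by linarith
    have h2 : u * (x * u) ≤ (B + v) * (B + v) := by
      have : x * u ≤ u := mul_le_of_le_one_left hu hx1
      exact mul_le_mul huB (by linarith) (by positivity) (by linarith)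
    have h3 : u * (1 - x) ≤ (B + v) * B :=
      mul_le_mul huB hB' (by linarith) (by linarith)
    have h4 : 0 ≤ u * (1 - x) := mul_nonneg hu (by linarith)
    have h5 : 0 ≤ u * (x * u) := by positivity
    rw [abs_le]
    -- 2(B + v)² ≤ 3B² + 6v² is (B - 2v)² ≥ 0.
    constructor <;> nlinarith [sq_nonneg (B - 2 * v), sq_nonneg (B - v)]
  have e2 : q₁ - geomApprox x u 1 = -(x - q₁) - (geomApprox x u 1 - x) := by ring
  rw [e2]
  refine (abs_sub _ _).trans ?_
  rw [abs_neg]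
  linarith

namespace IsRunSeq

variable {q : ℕ → ℝ}

theorem abs_sub_geomApprox_succ_le' (q : ℕ → ℝ) {x u : ℝ} (hu : 0 ≤ u) {n : ℕ}
    (hn : 0 ≤ q n) :
    |q (n + 1) - geomApprox x u (n + 1)| ≤ |recursionDefect q n|
      + |scanRatio (q 1 - q 2) - scanRatio u| * q n + |q n - geomApprox x u n| := by
  have e : q (n + 1) - geomApprox x u (n + 1) = recursionDefect q n
      + (scanRatio (q 1 - q 2) - scanRatio u) * q n + scanRatio u * (q n - geomApprox x u n) := by
    unfold recursionDefect geomApprox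
    ring
  rw [e]
  refine (abs_add_three _ _ _).trans (add_le_add (add_le_add le_rfl ?_) ?_)
  · rw [abs_mul, abs_of_nonneg hn]
  · rw [abs_mul, abs_of_pos (scanRatio_pos u)]
    exact mul_le_of_le_one_left (abs_nonneg _) (scanRatio_le_one hu)

theorem abs_scanRatio_sub_mul_one_le (hq : IsRunSeq q) {u v : ℝ} (hu : 0 ≤ u)
    (huv : |u - (q 1 - q 2)| ≤ v) :
    |scanRatio (q 1 - q 2) - scanRatio u| * q 1 ≤ v + v * u := by
  have h0 := hq.diff_nonneg
  have h1 := hq.diff_le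
  refine (mul_abs_scanRatio_sub_le (k := 1 + u) h0 hu ?_).trans ?_
  · generalize q 1 - q 2 = A at *
    have h2 : q 1 * (1 + 2 * u + 2 * A) ≤ (1 - A) * (1 + 2 * u + 2 * A) := by
      gcongr; linarith
    have h3 : (1 - A) * (1 + 2 * u + 2 * A) ≤ (1 + u) * ((1 + A) * (1 + u)) := by
      nlinarith [mul_nonneg h0 hu, sq_nonneg u, mul_nonneg h0 (sq_nonneg u)]
    exact h2.trans (h3.trans (mul_le_mul_of_nonneg_left (one_add_mul_one_add_le_denom _ hu)
      (by linarith)))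
  · have := mul_le_mul_of_nonneg_right huv (show 0 ≤ 1 + u by linarith)
    linarith

/-- Since q(n+2) ≤ q(2) ≤ 1 - 2A with A = q(1) - q(2), the weight absorbs the 2A in the difference
quotient of ρ. The leading constant is thus exactly 1, as the budget for v requires. -/
theorem abs_scanRatio_sub_mul_le (hq : IsRunSeq q) {u v : ℝ} (hu : 0 ≤ u)
    (huv : |u - (q 1 - q 2)| ≤ v) (n : ℕ) :
    |scanRatio (q 1 - q 2) - scanRatio u| * q (n + 2) ≤ v + v ^ 2 := by
  have h0 := hq.diff_nonneg
  have h1 := hq.diff_le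
  refine (mul_abs_scanRatio_sub_le (k := 1 + |u - (q 1 - q 2)|) h0 hu ?_).trans ?_
  · have hn : q (n + 2) ≤ 1 - 2 * (q 1 - q 2) := by
      have : q (n + 2) ≤ q 2 := hq.antitone (by omega)
      linarith
    generalize q 1 - q 2 = A at *
    have h2 : q (n + 2) * (1 + 2 * u + 2 * A) ≤ (1 - 2 * A) * (1 + 2 * u + 2 * A) := by gcongr
    have h3 : (1 - 2 * A) * (1 + 2 * u + 2 * A) ≤ 1 + 2 * u := by nlinarith [mul_nonneg h0 hu]
    have h4 : 1 + 2 * u ≤ (1 + |u - A|) * ((1 + A) * (1 + u)) := by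
      rcases le_total u A with h | h
      · have h5 : 1 + 2 * u ≤ (1 + A) * (1 + u) := by nlinarith [mul_nonneg h0 hu]
        refine h5.trans (le_mul_of_one_le_left (by positivity) ?_)
        linarith [abs_nonneg (u - A)]
      · rw [abs_of_nonneg (sub_nonneg.2 h)]
        nlinarith [mul_nonneg h0 hu, mul_nonneg (sub_nonneg.2 h) (mul_nonneg h0 hu), sq_nonneg (u - A)]
    exact h2.trans (h3.trans (h4.trans (mul_le_mul_of_nonneg_left
      (one_add_mul_one_add_le_denom _ hu) (by positivity))))
  · have := abs_nonneg (u - (q 1 - q 2))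
    nlinarith

/-- Perturbation of the one-dimensional approximation. -/
theorem abs_sub_geomApprox_perturbed_le (hq : IsRunSeq q) {x u e v B : ℝ}
    (hx0 : 0 ≤ x) (hx1 : x ≤ 1) (hu : 0 ≤ u) (hxe : |x - q 1| ≤ e)
    (huv : |u - (q 1 - q 2)| ≤ v) (hB : 1 - q 1 ≤ B) (hB' : 1 - x ≤ B) (n : ℕ) :
    |q (n + 1) - geomApprox x u (n + 1)| ≤ e + 3 * B ^ 2 + 6 * v ^ 2 + v * u + n * (v + v ^ 2)
      + ∑ i ∈ Finset.range n, |recursionDefect q (i + 1)| := by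
  have hv : 0 ≤ v := (abs_nonneg _).trans huv
  have hvu := mul_nonneg hv hu
  have h1 := abs_sub_geomApprox_one_le hx0 hx1 hu hxe huv hq.diff_le hB hB'
  match n with
  | 0 => norm_num; linarith
  | n + 1 =>
    induction n with
    | zero =>
      have h2 := abs_sub_geomApprox_succ_le' q (x := x) hu (hq.nonneg 1)
      have h3 := hq.abs_scanRatio_sub_mul_one_le hu huv
      norm_num at h2 ⊢
      have := sq_nonneg v
      linarith
    | succ n ih =>
      have h2 := abs_sub_geomApprox_succ_le' q (x := x) hu (hq.nonneg (n + 2))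
      have h3 := hq.abs_scanRatio_sub_mul_le hu huv n
      rw [Finset.sum_range_succ]
      rw [show n + 1 + 1 = n + 2 from rfl] at *
      push_cast at ih ⊢
      linarith

end IsRunSeq

/-! ### The two-dimensional estimate. -/

/-- The error terms of the perturbed approximation fit into the stated bound. -/
theorem perturbation_budget {l p P B E₂ E₃ D u S F : ℝ} (hl : 0 ≤ l) (hp : 0 ≤ p) (hP : 0 ≤ P)
    (hP1 : P ≤ 0.1) (hB : P ≤ B) (hE₂ : 0 ≤ E₂) (hE : E₂ ≤ E₃) (hv : E₂ + E₃ ≤ 2 * p)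
    (hD : E₂ + E₃ + (6 * p ^ 2 + 176 * p ^ 3) ≤ D) (hu : u ≤ P + (E₂ + E₃))
    (hS : S ≤ (l + 1) * (P ^ 2 + 6 * P ^ 3))
    (hF : l + 1 + 3 + (88 + 11 * (l + 1)) * P ≤ (l + 1) * F) :
    E₂ + 3 * B ^ 2 + 6 * (E₂ + E₃) ^ 2 + (E₂ + E₃) * u + l * (E₂ + E₃ + (E₂ + E₃) ^ 2) + S
      ≤ (l + 1) * F * B ^ 2 + (l + 1) * D := by
  obtain ⟨v, hv'⟩ : ∃ v, v = E₂ + E₃ := ⟨_, rfl⟩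
  rw [← hv'] at hv hD hu ⊢
  have hv0 : 0 ≤ v := by linarith
  have h1 := mul_le_mul_of_nonneg_left hu hv0
  have h2 : v * P ≤ v * 0.1 := by gcongr
  have h3 : v ^ 2 ≤ v * (2 * p) := by rw [sq]; gcongr
  have h4 : v * (2 * p) ≤ 2 * p * (2 * p) := by gcongr
  have hp3 : 0 ≤ p ^ 3 := by positivity
  -- One share of v in (l + 1)D has to pay for E₂ ≤ v/2, for v P ≤ 0.1 v and for 7v², which leaves
  -- 0.4 v for the last. If 14p > 0.4, the rest is paid by 6p² + 176p³, since 176p² - 22p + 0.8 has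
  -- negative discriminant.
  have h5 : 7 * v ^ 2 ≤ 0.4 * v + (6 * p ^ 2 + 176 * p ^ 3) := by
    rcases le_total (14 * p) 0.4 with h6 | h6
    · have := mul_le_mul_of_nonneg_left h6 hv0
      have := sq_nonneg p
      linarith
    · have h7 := mul_le_mul_of_nonneg_right hv (sub_nonneg.2 h6)
      have h8 : 0 ≤ p * (176 * p ^ 2 - 22 * p + 0.8) :=
        mul_nonneg hp (by nlinarith [sq_nonneg (16 * p - 0.6875)])
      linarith
  have h6 : P ^ 2 ≤ B ^ 2 := by gcongr
  have h7 := mul_le_mul_of_nonneg_left h6 hP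
  have h8 := mul_le_mul_of_nonneg_right hF (sq_nonneg B)
  -- v² ≤ 4p², so the remaining l shares of 6p² in (l + 1)D cover l v².
  have h9 : l * v ^ 2 ≤ l * (6 * p ^ 2) := by
    have := sq_nonneg p
    exact mul_le_mul_of_nonneg_left (by linarith) hl
  have h10 := mul_le_mul_of_nonneg_left h6 (show 0 ≤ l + 1 by linarith)
  have h11 := mul_le_mul_of_nonneg_left h7 (show 0 ≤ l + 1 by linarith)
  have h12 := mul_le_mul_of_nonneg_left hD (show 0 ≤ l + 1 by linarith)
  have h13 : 0 ≤ l * p ^ 3 := by positivity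
  have h14 : 0 ≤ l * (P * B ^ 2) := by positivity
  have h15 : 0 ≤ P * B ^ 2 := by positivity
  linarith

/-- The probabilities `G m k` that all blocks of an `m × k` rectangle are good, in a stationary
one-dependent field. -/
structure IsRunField (G : ℕ → ℕ → ℝ) : Prop where
  row : ∀ k, IsRunSeq fun m => G m k
  col : ∀ m, IsRunSeq fun k => G m k
  two_mul : G 1 2 - G 2 2 ≤ 2 * (G 1 1 - G 2 1)

namespace IsRunField

variable {G : ℕ → ℕ → ℝ}

theorem one_sub_le_two_mul (hG : IsRunField G) (m : ℕ) : 1 - G m 2 ≤ 2 * (1 - G m 1) := by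
  have := (hG.col m).diff_le
  linarith

/-- Bounds for the sum of the errors of the two one-dimensional approximations. -/
theorem sum_errors_le (hG : IsRunField G) {m : ℕ} (hm : 1 ≤ m) (h1 : 0.9 ≤ G m 1) :
    (m : ℝ) * ((1 - G 1 1) ^ 2 + 6 * (1 - G 1 1) ^ 3)
      + m * ((1 - G 1 2) ^ 2 + 6 * (1 - G 1 2) ^ 3) ≤ 2 * (1 - G 1 1) := by
  have h3 := (hG.row 1).mul_le_one_sub hm h1
  have h4 := hG.one_sub_le_two_mul 1
  have h5 : 0 ≤ 1 - G 1 1 := sub_nonneg.2 ((hG.row 1).le_one 1)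
  have h6 : 0 ≤ 1 - G 1 2 := sub_nonneg.2 ((hG.row 2).le_one 1)
  generalize 1 - G 1 1 = p at *
  generalize 1 - G 1 2 = p' at *
  have hm' : (1 : ℝ) ≤ m := by exact_mod_cast hm
  -- From 0.3 (m + 2) p ≤ 0.1, rounded up.
  have h7 : (m : ℝ) * p ≤ 0.334 - 2 * p := by linarith
  have h8 : p' ^ 2 ≤ 4 * p ^ 2 := by nlinarith
  have h9 : p' ^ 3 ≤ 8 * p ^ 3 := by
    calc p' ^ 3 ≤ (2 * p) ^ 3 := by gcongr
      _ = 8 * p ^ 3 := by ring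
  have h10 : (m : ℝ) * (p ^ 2 + 6 * p ^ 3) + m * (p' ^ 2 + 6 * p' ^ 3)
      ≤ m * (5 * p ^ 2 + 54 * p ^ 3) := by
    rw [← mul_add]
    exact mul_le_mul_of_nonneg_left (by linarith) m.cast_nonneg
  have h11 : (m : ℝ) * (5 * p ^ 2 + 54 * p ^ 3) = (m * p) * (p * (5 + 54 * p)) := by ring
  have h12 : (m * p) * (p * (5 + 54 * p)) ≤ (0.334 - 2 * p) * (p * (5 + 54 * p)) := by gcongr
  nlinarith [mul_nonneg h5 (sq_nonneg (27 * p - 1))]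

theorem geomApprox_nonneg_and_le_one {q : ℕ → ℝ} (hq : IsRunSeq q) (hp : 0.9 ≤ q 1) (m : ℕ) :
    0 ≤ geomApprox (q 1) (q 1 - q 2) m ∧ geomApprox (q 1) (q 1 - q 2) m ≤ 1 := by
  have h0 := hq.diff_nonneg
  have h1 := hq.diff_le
  have h2 := pow_nonneg (scanRatio_pos (q 1 - q 2)).le m
  have h3 := pow_le_one₀ (n := m) (scanRatio_pos (q 1 - q 2)).le (scanRatio_le_one h0)
  exact ⟨mul_nonneg (by linarith) h2, mul_le_one₀ (by linarith) h2 h3⟩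

theorem abs_sub_H_le (hG : IsRunField G) {L₁ L₂ : ℕ} (hL₁ : 1 ≤ L₁) (hL₂ : 1 ≤ L₂)
    (h1 : 0.9 ≤ G L₁ 1) (h2 : 0.9 ≤ G 1 2) {R₂ R₃ F f₂ f₃ : ℝ}
    (hR₂ : R₂ = ScanBound.H (G 1 1) (G 2 1) L₁) (hR₃ : R₃ = ScanBound.H (G 1 2) (G 2 2) L₁)
    (hF : L₂ + 3 + (88 + 11 * L₂) * (1 - G L₁ 1) ≤ L₂ * F)
    (hf₂ : L₁ + 3 + (88 + 11 * L₁) * (1 - G 1 1) ≤ L₁ * f₂)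
    (hf₃ : L₁ + 3 + (88 + 11 * L₁) * (1 - G 1 2) ≤ L₁ * f₃) :
    |G L₁ L₂ - ScanBound.H R₂ R₃ L₂| ≤ ScanBound.appError L₁ L₂ F f₂ f₃ R₂ (G 1 1) (G 1 2) := by
  have hr1 := hG.row 1
  have hr2 := hG.row 2
  have hc := hG.col L₁
  have g11 : G 1 2 ≤ G 1 1 := (hG.col 1).anti 1
  have g1 : 1 - G 1 1 ≤ 0.1 := by linarith
  have g2 : 1 - G 1 2 ≤ 0.1 := by linarith
  have e2 : |G L₁ 1 - R₂| ≤ L₁ * ((1 - G 1 1) ^ 2 + 6 * (1 - G 1 1) ^ 3) := by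
    rw [hR₂, H_eq_geomApprox]; exact hr1.abs_sub_geomApprox_le g1 hL₁
  have e3 : |G L₁ 2 - R₃| ≤ L₁ * ((1 - G 1 2) ^ 2 + 6 * (1 - G 1 2) ^ 3) := by
    rw [hR₃, H_eq_geomApprox]; exact hr2.abs_sub_geomApprox_le g2 hL₁
  have hu : R₃ ≤ R₂ := by
    rw [hR₂, hR₃, H_eq_geomApprox, H_eq_geomApprox]
    exact hr1.geomApprox_le_geomApprox hr2 hL₁ h1 h2 (hc.diff_ge h1) (hG.one_sub_le_two_mul 1)
      hG.two_mul
  have hx : 0 ≤ R₂ ∧ R₂ ≤ 1 := by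
    rw [hR₂, H_eq_geomApprox]
    exact geomApprox_nonneg_and_le_one hr1 (by linarith) L₁
  have hv := hG.sum_errors_le hL₁ h1
  have hp0 : 0 ≤ 1 - G 1 1 := sub_nonneg.2 (hr1.le_one 1)
  have hp0' : 0 ≤ 1 - G 1 2 := sub_nonneg.2 (hr2.le_one 1)
  have hP0 : 0 ≤ 1 - G L₁ 1 := sub_nonneg.2 (hr1.le_one L₁)
  obtain ⟨l, rfl⟩ : ∃ l, L₂ = l + 1 := ⟨L₂ - 1, by omega⟩
  have hS := hc.sum_abs_recursionDefect_le (by linarith : 1 - G L₁ 1 ≤ 0.1) l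
  have hA1 : G L₁ 1 - G L₁ 2 ≤ 1 - G L₁ 1 := hc.diff_le
  have hpp : 1 - G 1 1 ≤ 1 - G 1 2 := by linarith
  have hl1 : (1 : ℝ) ≤ L₁ := by exact_mod_cast hL₁
  have hl0 : (0 : ℝ) ≤ l := l.cast_nonneg
  have hd2 := mul_le_mul_of_nonneg_right hf₂ (sq_nonneg (1 - G 1 1))
  have hd3 := mul_le_mul_of_nonneg_right hf₃ (sq_nonneg (1 - G 1 2))
  have key := fun e v B ha hb hc' hd =>
    hc.abs_sub_geomApprox_perturbed_le (x := R₂) (u := R₂ - R₃) (e := e) (v := v) (B := B)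
      hx.1 hx.2 (sub_nonneg.2 hu) ha hb hc' hd l
  rw [H_eq_geomApprox]
  unfold ScanBound.appError
  obtain ⟨p, hp⟩ : ∃ p, p = 1 - G 1 1 := ⟨_, rfl⟩
  obtain ⟨p', hp'⟩ : ∃ p', p' = 1 - G 1 2 := ⟨_, rfl⟩
  obtain ⟨E₂, hE₂⟩ : ∃ E₂, E₂ = (L₁ : ℝ) * (p ^ 2 + 6 * p ^ 3) := ⟨_, rfl⟩
  obtain ⟨E₃, hE₃⟩ : ∃ E₃, E₃ = (L₁ : ℝ) * (p' ^ 2 + 6 * p' ^ 3) := ⟨_, rfl⟩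
  rw [← hp, ← hp', ← hE₂, ← hE₃] at hv
  rw [← hp, ← hE₂] at e2
  rw [← hp', ← hE₃] at e3
  rw [← hp] at hd2 hp0 hpp ⊢
  rw [← hp'] at hd3 hp0' hpp ⊢
  have hp3 : 0 ≤ p ^ 3 := by positivity
  have hp3' : p ^ 3 ≤ p' ^ 3 := by gcongr
  have hp2' : p ^ 2 ≤ p' ^ 2 := by gcongr
  have s2 : E₂ + (3 * p ^ 2 + 88 * p ^ 3) ≤ L₁ * f₂ * p ^ 2 := by
    have : 0 ≤ (L₁ : ℝ) * p ^ 3 := by positivity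
    linarith
  have s3 : E₃ + (3 * p ^ 2 + 88 * p ^ 3) ≤ L₁ * f₃ * p' ^ 2 := by
    have : 0 ≤ (L₁ : ℝ) * p' ^ 3 := by positivity
    linarith
  have hE₂0 : 0 ≤ E₂ := by rw [hE₂]; positivity
  have hE : E₂ ≤ E₃ := by
    rw [hE₂, hE₃]
    gcongr
  obtain ⟨b2, b2'⟩ := abs_le.1 e2
  obtain ⟨b3, b3'⟩ := abs_le.1 e3
  have hs : 0 ≤ 3 * p ^ 2 + 88 * p ^ 3 := by positivity
  -- L₁ f₂ p² exceeds E₂, so B₂ dominates both 1 - R₂ and the true 1 - G(L₁,1).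
  have hB1 : 1 - G L₁ 1 ≤ 1 - R₂ + L₁ * f₂ * p ^ 2 := by linarith
  have k := key E₂ (E₂ + E₃) (1 - R₂ + L₁ * f₂ * p ^ 2) (by rw [abs_sub_comm]; exact e2)
    (abs_le.2 ⟨by linarith, by linarith⟩) hB1 (by linarith)
  refine k.trans ((perturbation_budget (D := L₁ * f₂ * p ^ 2 + L₁ * f₃ * p' ^ 2) (F := F) hl0 hp0
    hP0 (by linarith) hB1 hE₂0 hE hv (by linarith) (by linarith) hS ?_).trans_eq ?_)
  · push_cast at hF
    exact hF
  · push_cast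
    ring

end IsRunField

/-! ### Lower bounds for K, Γ and F. -/

namespace ScanBound

/-- The first summand of the numerator is at least 11, the second is nonnegative, and the
denominator lies in (0, 1]. -/
theorem K_ge {α l : ℝ} (h0 : 0 ≤ α) (h1 : α ≤ 0.1) (h : Admissible α l) : 11 ≤ K α l := by
  have ht : 0 ≤ t₂ α := Real.sInf_nonneg fun t ht => ht.1.le
  have hl : 0 < l := (pow_nonneg ht 3).trans_lt h.lt
  have h2 := h.pos₁
  have h3 := h.pos₂
  unfold η at h2 h3
  have hd : 0 < (1 - α) ^ 2 := by nlinarith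
  have hY : 1 - 2 * α * (1 + l * α) / (1 - α * (1 + l * α) ^ 2) ^ 2 ≤ 1 := by
    have : 0 ≤ 2 * α * (1 + l * α) / (1 - α * (1 + l * α) ^ 2) ^ 2 := by positivity
    linarith
  have hX1 : 11 ≤ (11 - 3 * α) / (1 - α) ^ 2 := by
    rw [le_div_iff₀ hd]
    nlinarith
  have hnum : 0 ≤ 2 + 3 * l * α - α * (2 - l * α) * (1 + l * α) ^ 2 := by
    have hs : 0 ≤ l * α := by positivity
    -- The numerator rewritten with s = lα, using (2 - s)(1 + s)² = 2 + 3s - s³.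
    have : 0 ≤ (2 + 3 * (l * α)) * (1 - α) + α * (l * α) ^ 3 := by
      have : 0 ≤ 1 - α := by linarith
      positivity
    linarith
  have hX2 : 0 ≤ 2 * l * (1 + 3 * α) * ((2 + 3 * l * α - α * (2 - l * α) * (1 + l * α) ^ 2)
        / (1 - α * (1 + l * α) ^ 2) ^ 3) := by positivity
  unfold K
  rw [le_div_iff₀ h3]
  linarith

theorem E_nonneg {α l : ℝ} (h0 : 0 ≤ α) (h1 : α ≤ 0.1) (h : Admissible α l) : 0 ≤ E α l := by
  have ht : 0 ≤ t₂ α := Real.sInf_nonneg fun t ht => ht.1.le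
  have hl : 0 < l := (pow_nonneg ht 3).trans_lt h.lt
  have h2 := h.pos₁
  have h3 := h.pos₃
  have hη : 1 ≤ η α l := by
    have : 0 ≤ l * α := by positivity
    unfold η
    linarith
  have h4 : 0 ≤ 1 + α * (η α l - 2) := by nlinarith
  have h5 : 0 ≤ 1 - 3 * α := by linarith
  have h6 : 0 ≤ η α l := by linarith
  unfold E
  refine div_nonneg ?_ (by positivity)
  have : 0 ≤ (1 + (1 - 2 * α) * η α l) ^ 4 := by positivity
  positivity

/-- 3K + 55.1 ≥ 33 + 55.1, the other terms being nonnegative. -/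
theorem Gam_ge {α l : ℝ} (h0 : 0 ≤ α) (h1 : α ≤ 0.1) (h : Admissible α l) : 88 ≤ Gam α l := by
  have hK := K_ge h0 h1 h
  have hE := E_nonneg h0 h1 h
  have hc : 1 ≤ 1 + α + 3 * α ^ 2 := by nlinarith
  have h2 : 3 * K α l ≤ 3 * K α l * (1 + α + 3 * α ^ 2) :=
    le_mul_of_one_le_right (by linarith) hc
  have h3 : 0 ≤ K α l * α ^ 3 := by positivity
  have h4 : 3 * K α l * (1 + α + 3 * α ^ 2) ≤
      3 * K α l * (1 + α + 3 * α ^ 2) * (1 + α + 3 * α ^ 2 + K α l * α ^ 3) :=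
    le_mul_of_one_le_right (by linarith) (by linarith)
  have h5 : 0 ≤ α ^ 6 * K α l ^ 3 := by positivity
  have h6 : 0 ≤ 9 * α * (4 + 3 * α + 3 * α ^ 2) := by positivity
  unfold Gam Lam
  linarith

theorem le_mul_F {α l : ℝ} (h0 : 0 ≤ α) (h1 : α ≤ 0.1) (h : Admissible α l) {m : ℕ}
    (hm : 1 ≤ m) {q r : ℝ} (hq : q ≤ r) (hr : r ≤ 1) :
    m + 3 + (88 + 11 * m) * (1 - r) ≤ m * F α l m q := by
  have hK := K_ge h0 h1 h
  have hG := Gam_ge h0 h1 h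
  have hm' : (0 : ℝ) < m := by exact_mod_cast hm
  have e : m * F α l m q = m + 3 + (Gam α l + K α l * m) * (1 - q) := by
    unfold F
    field_simp
  rw [e]
  have : (88 + 11 * m) * (1 - r) ≤ (Gam α l + K α l * m) * (1 - q) := by
    have : 0 ≤ 1 - r := by linarith
    gcongr
  linarith

end ScanBound

/-! ### Run sequences from events, and independence in product spaces. -/

/-- A family of events `I s n`, to be thought of as `A_{s+1} ∩ ⋯ ∩ A_{s+n}`, that is stationary and
one-dependent has run probabilities `P (I 0 n)`. -/
theorem isRunSeq_measureReal {Ω : Type*} [MeasurableSpace Ω] {μ : Measure Ω}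
    [IsProbabilityMeasure μ] {I : ℕ → ℕ → Set Ω} (hmeas : ∀ s n, MeasurableSet (I s n))
    (hzero : ∀ s, I s 0 = Set.univ) (hadd : ∀ s m n, I s (m + n) = I s m ∩ I (s + m) n)
    (hstat : ∀ s n, μ.real (I s n) = μ.real (I 0 n))
    (hindep : ∀ k s n, k + 1 ≤ s → μ.real (I 0 k ∩ I s n) = μ.real (I 0 k) * μ.real (I s n)) :
    IsRunSeq fun n => μ.real (I 0 n) := by
  have hcompl : ∀ {s t : Set Ω}, MeasurableSet t →
      μ.real (s ∩ tᶜ) = μ.real s - μ.real (s ∩ t) := fun {s t} ht => by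
    rw [← measureReal_inter_add_sdiff (s := s) ht, Set.sdiff_eq]; ring
  have e1 : ∀ n, I 0 (n + 1) = I 0 n ∩ I n 1 := fun n => by simpa using hadd 0 n 1
  have e2 : ∀ n, I n 2 = I n 1 ∩ I (n + 1) 1 := fun n => hadd n 1 1
  have m1 := fun n => hmeas n 1
  -- the four probabilities with gaps
  have p1 : ∀ n, μ.real (I 0 n ∩ I (n + 1) 1) = μ.real (I 0 n) * μ.real (I 0 1) := fun n => by
    rw [hindep _ _ _ le_rfl, hstat (n + 1)]
  have p2 : ∀ n, μ.real (I 0 n ∩ I (n + 2) 1) = μ.real (I 0 n) * μ.real (I 0 1) := fun n => by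
    rw [hindep _ _ _ (by omega), hstat (n + 2)]
  have p3 : ∀ n, μ.real (I 0 n ∩ (I (n + 1) 1 ∩ I (n + 2) 1))
      = μ.real (I 0 n) * μ.real (I 0 2) := fun n => by
    rw [← e2 (n + 1), hindep _ _ _ le_rfl, hstat (n + 1)]
  have p4 : ∀ n, μ.real (I 0 n ∩ (I n 1 ∩ I (n + 2) 1))
      = μ.real (I 0 (n + 1)) * μ.real (I 0 1) := fun n => by
    rw [← Set.inter_assoc, ← e1, p1]
  have q1 : ∀ n, I 0 n ∩ (I n 1 ∩ I (n + 1) 1) = I 0 (n + 2) := fun n => by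
    rw [← Set.inter_assoc, ← e1, ← e1]
  have q2 : ∀ n, I 0 n ∩ (I n 1 ∩ (I (n + 1) 1 ∩ I (n + 2) 1)) = I 0 (n + 3) := fun n => by
    rw [← Set.inter_assoc, ← e1, ← Set.inter_assoc, ← e1, ← e1]
  have anti : ∀ n, μ.real (I 0 (n + 1)) ≤ μ.real (I 0 n) := fun n =>
    measureReal_mono (by rw [e1]; exact Set.inter_subset_left)
  have gap : ∀ n, μ.real (I 0 (n + 2)) - μ.real (I 0 (n + 3))
      ≤ (μ.real (I 0 1) - μ.real (I 0 2)) * μ.real (I 0 n) := fun n => by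
    have h1 : μ.real (I 0 (n + 2) ∩ (I (n + 2) 1)ᶜ)
        ≤ μ.real ((I 0 n ∩ I (n + 1) 1) ∩ (I (n + 2) 1)ᶜ) := by
      refine measureReal_mono (Set.inter_subset_inter_left _ ?_)
      rw [← q1]
      exact Set.inter_subset_inter_right _ Set.inter_subset_right
    rw [hcompl (m1 _), hcompl (m1 _), ← e1, Set.inter_assoc, p3, p1] at h1
    linarith
  -- the probability of three consecutive failures, and of two failures with a gap
  have triple : ∀ n, μ.real (((I 0 n ∩ (I n 1)ᶜ) ∩ (I (n + 2) 1)ᶜ) ∩ (I (n + 1) 1)ᶜ)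
      = μ.real (I 0 n) * (1 - 2 * μ.real (I 0 1) + μ.real (I 0 2))
        - μ.real (I 0 (n + 1)) * (1 - μ.real (I 0 1))
        + μ.real (I 0 (n + 2)) - μ.real (I 0 (n + 3)) := fun n => by
    -- Inclusion-exclusion over the two outer failures inside an arbitrary event; the middle failure
    -- is then the difference of the cases of the whole space and of a good middle block.
    have c1 : ∀ t : Set Ω, MeasurableSet t →
        μ.real (((I 0 n ∩ (I n 1)ᶜ) ∩ (I (n + 2) 1)ᶜ) ∩ t)
        = μ.real (I 0 n ∩ t) - μ.real (I 0 n ∩ (I n 1 ∩ t))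
          - μ.real (I 0 n ∩ (t ∩ I (n + 2) 1)) + μ.real (I 0 n ∩ (I n 1 ∩ (t ∩ I (n + 2) 1))) := by
      intro t ht
      have r1 : ((I 0 n ∩ (I n 1)ᶜ) ∩ (I (n + 2) 1)ᶜ) ∩ t
          = ((I 0 n ∩ t) ∩ (I (n + 2) 1)ᶜ) ∩ (I n 1)ᶜ := by ext; simp; tauto
      have r2 : I 0 n ∩ t ∩ (I (n + 2) 1)ᶜ ∩ I n 1
          = (I 0 n ∩ (I n 1 ∩ t)) ∩ (I (n + 2) 1)ᶜ := by ext; simp; tauto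
      rw [r1, hcompl (m1 _), r2, hcompl (m1 _), hcompl (m1 _)]
      simp only [Set.inter_assoc]
      ring
    have c2 := c1 Set.univ .univ
    simp only [Set.inter_univ, Set.univ_inter] at c2
    rw [hcompl (m1 _), c2, c1 _ (m1 _), p1, p2, p3, p4, q1, q2, ← e1]
    ring
  refine ⟨by simp [hzero], fun _ => measureReal_nonneg, anti, fun n => ?_, ?_, fun n => ?_,
    fun n => ?_, gap⟩
  · have h1 : μ.real (I 0 (n + 1) ∩ (I (n + 1) 1)ᶜ) ≤ μ.real (I 1 n ∩ (I (n + 1) 1)ᶜ) := by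
      refine measureReal_mono (Set.inter_subset_inter_left _ ?_)
      rw [add_comm, hadd, zero_add]
      exact Set.inter_subset_right
    have h2 : I 1 n ∩ I (n + 1) 1 = I 1 (n + 1) := by rw [hadd, add_comm 1 n]
    rwa [hcompl (m1 _), hcompl (m1 _), ← e1, h2, hstat 1, hstat 1] at h1
  · have h1 : I 0 3 ⊆ I 0 1 ∩ I 2 1 := by
      rw [← q2 0, hzero]
      simp only [Set.univ_inter, zero_add]
      exact Set.inter_subset_inter_right _ Set.inter_subset_right
    have h2 := measureReal_mono (μ := μ) h1
    rw [p1 1] at h2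
    linarith
  · have h1 := triple n
    have h2 : 0 ≤ μ.real (((I 0 n ∩ (I n 1)ᶜ) ∩ (I (n + 2) 1)ᶜ) ∩ (I (n + 1) 1)ᶜ) :=
      measureReal_nonneg
    linarith
  · have h1 := triple n
    have h2 : μ.real (((I 0 n ∩ (I n 1)ᶜ) ∩ (I (n + 2) 1)ᶜ) ∩ (I (n + 1) 1)ᶜ)
        ≤ μ.real ((I 0 n ∩ (I n 1)ᶜ) ∩ (I (n + 2) 1)ᶜ) := measureReal_mono Set.inter_subset_left
    have r : I 0 n ∩ (I n 1)ᶜ ∩ I (n + 2) 1 = (I 0 n ∩ I (n + 2) 1) ∩ (I n 1)ᶜ := by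
      ext; simp; tauto
    have r' : I 0 n ∩ I (n + 2) 1 ∩ I n 1 = I 0 n ∩ (I n 1 ∩ I (n + 2) 1) := by
      ext; simp; tauto
    rw [hcompl (m1 (n + 2)), r, hcompl (m1 n), hcompl (m1 n), r', ← e1, p2, p4] at h2
    linarith

/-- Events that depend on disjoint finite sets of coordinates of a product measure are
independent. -/
theorem measureReal_inter_of_dependsOn {ι : Type*} {X : Type*} [MeasurableSpace X] [Inhabited X]
    (ν : Measure X) [IsProbabilityMeasure ν] {S T : Finset ι} (hST : Disjoint S T)
    {A B : Set (ι → X)} (hA : MeasurableSet A) (hB : MeasurableSet B)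
    (hAS : DependsOn (fun f => f ∈ A) S) (hBT : DependsOn (fun f => f ∈ B) T) :
    (Measure.infinitePi fun _ : ι => ν).real (A ∩ B)
      = (Measure.infinitePi fun _ : ι => ν).real A * (Measure.infinitePi fun _ : ι => ν).real B := by
  classical
  have hind := (iIndepFun_infinitePi (P := fun _ : ι => ν) (X := fun _ x => x)
    (fun _ => measurable_id)).indepFun_finset S T hST (fun i => measurable_pi_apply i)
  -- Coordinates outside `S` get an arbitrary value, so an event depending only on `S` becomes the
  -- preimage of an event about the finite tuple.
  let ext (S : Finset ι) (z : S → X) (i : ι) : X := if h : i ∈ S then z ⟨i, h⟩ else default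
  have hext : ∀ S, Measurable (ext S) := fun S => by
    refine measurable_pi_lambda _ fun i => ?_
    by_cases h : i ∈ S
    · simpa [ext, h] using measurable_pi_apply _
    · simp [ext, h]
  have hpre : ∀ (S : Finset ι) (A : Set (ι → X)), DependsOn (fun f => f ∈ A) S →
      (fun (f : ι → X) (i : S) => f i) ⁻¹' (ext S ⁻¹' A) = A := fun S A hAS => by
    ext f
    have : ext S (fun i : S => f i) ∈ A ↔ f ∈ A := by
      refine iff_of_eq (hAS fun i hi => ?_)
      simp only [ext]
      rw [dif_pos (Finset.mem_coe.1 hi)]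
    exact this
  have h := hind.measure_inter_preimage_eq_mul _ _ (hext S hA) (hext T hB)
  rw [hpre S A hAS, hpre T B hBT] at h
  simp only [measureReal_def, h, ENNReal.toReal_mul]

/-! ### The good-rectangle events: locality, translation, splitting. -/

namespace ScanParams

/-- The window extends m₁ - 1 beyond its first column and the matrix another c₁ - 1, together b₁;
likewise vertically. -/
theorem windowSum_congr (P : ScanParams) (hm₁ : 1 ≤ P.m₁) (hm₂ : 1 ≤ P.m₂)
    (T : Matrix (Fin P.c₂) (Fin P.c₁) ℝ → ℝ) {X Y : ℕ → ℕ → ℝ} {i₁ i₂ : ℕ}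
    (h : ∀ i ∈ Set.Icc i₁ (i₁ + P.b₁), ∀ j ∈ Set.Icc i₂ (i₂ + P.b₂), X i j = Y i j) :
    P.windowSum T X i₁ i₂ = P.windowSum T Y i₁ i₂ := by
  refine Finset.sum_congr rfl fun i hi => Finset.sum_congr rfl fun j hj => congrArg T ?_
  ext k l
  have hk := k.isLt
  have hl := l.isLt
  rw [Finset.mem_Ico] at hi hj
  refine h _ ⟨?_, ?_⟩ _ ⟨?_, ?_⟩ <;> simp only [b₁, b₂, c₁, c₂] at * <;> omega

theorem windowSum_shift (P : ScanParams) (T : Matrix (Fin P.c₂) (Fin P.c₁) ℝ → ℝ)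
    (X : ℕ → ℕ → ℝ) (s t i₁ i₂ : ℕ) :
    P.windowSum T (fun i j => X (i + s) (j + t)) i₁ i₂ = P.windowSum T X (i₁ + s) (i₂ + t) := by
  unfold windowSum
  rw [add_right_comm i₁, add_right_comm i₂, ← Finset.sum_Ico_add']
  refine Finset.sum_congr rfl fun i _ => ?_
  rw [← Finset.sum_Ico_add']
  refine Finset.sum_congr rfl fun j _ => congrArg T ?_
  ext k l
  have hk := k.isLt
  simp only [configMatrix, c₂] at *
  congr 1 <;> omega

theorem measurable_windowSum (P : ScanParams) {T : Matrix (Fin P.c₂) (Fin P.c₁) ℝ → ℝ}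
    (hT : Measurable fun a : Fin P.c₂ → Fin P.c₁ → ℝ => T (Matrix.of a)) (i₁ i₂ : ℕ) :
    Measurable fun f : ℕ × ℕ → ℝ => P.windowSum T (fun i j => f (i, j)) i₁ i₂ := by
  refine Finset.measurable_sum _ fun i _ => Finset.measurable_sum _ fun j _ => ?_
  have h : Measurable fun (f : ℕ × ℕ → ℝ) (k : Fin P.c₂) (l : Fin P.c₁) =>
      f (i + P.x₁ - P.x₁ + l, j + P.y₁ + P.y₂ - k) :=
    measurable_pi_lambda _ fun k => measurable_pi_lambda _ fun l => measurable_pi_apply _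
  exact hT.comp h

/-- The configurations for which all moving sums with `s < i₁ ≤ s + m`, `t < i₂ ≤ t + k` are at
most `n`. -/
def rectEvent (P : ScanParams) (T : Matrix (Fin P.c₂) (Fin P.c₁) ℝ → ℝ) (n : ℝ) (s m t k : ℕ) :
    Set (ℕ × ℕ → ℝ) :=
  {f | ∀ i₁ ∈ Set.Ioc s (s + m), ∀ i₂ ∈ Set.Ioc t (t + k),
    P.windowSum T (fun i j => f (i, j)) i₁ i₂ ≤ n}

theorem measurableSet_rectEvent (P : ScanParams) {T : Matrix (Fin P.c₂) (Fin P.c₁) ℝ → ℝ}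
    (hT : Measurable fun a : Fin P.c₂ → Fin P.c₁ → ℝ => T (Matrix.of a)) (n : ℝ)
    (s m t k : ℕ) : MeasurableSet (P.rectEvent T n s m t k) := by
  have e : P.rectEvent T n s m t k = ⋂ i₁ ∈ Set.Ioc s (s + m), ⋂ i₂ ∈ Set.Ioc t (t + k),
      {f | P.windowSum T (fun i j => f (i, j)) i₁ i₂ ≤ n} := by
    ext f
    simp only [rectEvent, Set.mem_iInter, Set.mem_ofPred_eq]
  rw [e]
  exact .biInter (Set.to_countable _) fun i₁ _ => .biInter (Set.to_countable _) fun i₂ _ =>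
    measurableSet_le (P.measurable_windowSum hT i₁ i₂) measurable_const

theorem dependsOn_rectEvent (P : ScanParams) (hm₁ : 1 ≤ P.m₁) (hm₂ : 1 ≤ P.m₂)
    (T : Matrix (Fin P.c₂) (Fin P.c₁) ℝ → ℝ) (n : ℝ) (s m t k : ℕ) :
    DependsOn (fun f => f ∈ P.rectEvent T n s m t k)
      (Finset.Ioc s (s + m + P.b₁) ×ˢ Finset.Ioc t (t + k + P.b₂) : Finset (ℕ × ℕ)) := by
  intro f g hfg
  refine propext (forall₂_congr fun i₁ h₁ => forall₂_congr fun i₂ h₂ => ?_)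
  rw [P.windowSum_congr hm₁ hm₂ T (Y := fun i j => g (i, j))]
  intro i hi j hj
  refine hfg (i, j) ?_
  simp only [Set.mem_Ioc, Set.mem_Icc] at *
  simp only [Finset.coe_product, Finset.coe_Ioc, Set.mem_prod, Set.mem_Ioc]
  omega

theorem shift_preimage_rectEvent (P : ScanParams) (T : Matrix (Fin P.c₂) (Fin P.c₁) ℝ → ℝ) (n : ℝ)
    (a b m k : ℕ) :
    (fun (f : ℕ × ℕ → ℝ) p => f (p.1 + a, p.2 + b)) ⁻¹' P.rectEvent T n 0 m 0 k
      = P.rectEvent T n a m b k := by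
  ext f
  simp only [rectEvent, Set.mem_preimage, Set.mem_ofPred_eq, Set.mem_Ioc]
  have e := fun i₁ i₂ => P.windowSum_shift T (fun i j => f (i, j)) a b i₁ i₂
  simp only [e]
  constructor
  · intro h i₁ h₁ i₂ h₂
    have := h (i₁ - a) (by omega) (i₂ - b) (by omega)
    rwa [Nat.sub_add_cancel (by omega), Nat.sub_add_cancel (by omega)] at this
  · intro h i₁ h₁ i₂ h₂
    exact h _ (by omega) _ (by omega)

theorem rectEvent_add_left (P : ScanParams) (T : Matrix (Fin P.c₂) (Fin P.c₁) ℝ → ℝ) (n : ℝ)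
    (s m m' t k : ℕ) : P.rectEvent T n s (m + m') t k
      = P.rectEvent T n s m t k ∩ P.rectEvent T n (s + m) m' t k := by
  ext f
  simp only [rectEvent, Set.mem_inter_iff, Set.mem_ofPred_eq, Set.mem_Ioc]
  constructor
  · exact fun h => ⟨fun i₁ h₁ => h i₁ (by omega), fun i₁ h₁ => h i₁ (by omega)⟩
  · rintro ⟨h, h'⟩ i₁ h₁
    rcases le_or_gt i₁ (s + m) with h₂ | h₂
    · exact h i₁ (by omega)
    · exact h' i₁ (by omega)

theorem rectEvent_add_right (P : ScanParams) (T : Matrix (Fin P.c₂) (Fin P.c₁) ℝ → ℝ) (n : ℝ)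
    (s m t k k' : ℕ) : P.rectEvent T n s m t (k + k')
      = P.rectEvent T n s m t k ∩ P.rectEvent T n s m (t + k) k' := by
  ext f
  simp only [rectEvent, Set.mem_inter_iff, Set.mem_ofPred_eq, Set.mem_Ioc]
  constructor
  · exact fun h => ⟨fun i₁ h₁ i₂ h₂ => h i₁ h₁ i₂ (by omega),
      fun i₁ h₁ i₂ h₂ => h i₁ h₁ i₂ (by omega)⟩
  · rintro ⟨h, h'⟩ i₁ h₁ i₂ h₂
    rcases le_or_gt i₂ (t + k) with h₃ | h₃
    · exact h i₁ h₁ i₂ (by omega)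
    · exact h' i₁ h₁ i₂ (by omega)

theorem rectEvent_zero_left (P : ScanParams) (T : Matrix (Fin P.c₂) (Fin P.c₁) ℝ → ℝ) (n : ℝ)
    (s t k : ℕ) : P.rectEvent T n s 0 t k = Set.univ := by
  simp [rectEvent]

theorem rectEvent_zero_right (P : ScanParams) (T : Matrix (Fin P.c₂) (Fin P.c₁) ℝ → ℝ) (n : ℝ)
    (s m t : ℕ) : P.rectEvent T n s m t 0 = Set.univ := by
  simp [rectEvent]

/-! ### The good-block field of an infinite i.i.d. array. -/

section ProductMeasure

variable (ν : Measure ℝ) [IsProbabilityMeasure ν]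

theorem measureReal_rectEvent_shift (P : ScanParams) {T : Matrix (Fin P.c₂) (Fin P.c₁) ℝ → ℝ}
    (hT : Measurable fun a : Fin P.c₂ → Fin P.c₁ → ℝ => T (Matrix.of a)) (n : ℝ)
    (s m t k : ℕ) :
    (Measure.infinitePi fun _ : ℕ × ℕ => ν).real (P.rectEvent T n s m t k)
      = (Measure.infinitePi fun _ : ℕ × ℕ => ν).real (P.rectEvent T n 0 m 0 k) := by
  have hinj : Function.Injective fun p : ℕ × ℕ => (p.1 + s, p.2 + t) := fun p q h => by
    simp only [Prod.mk.injEq, add_left_inj] at h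
    exact Prod.ext h.1 h.2
  have h := Measure.map_infinitePi_infinitePi_of_inj (P := fun _ : ℕ × ℕ => ν) hinj
  rw [← P.shift_preimage_rectEvent T n s t m k]
  conv_rhs => rw [← h]
  rw [map_measureReal_apply (measurable_pi_lambda _ fun p => measurable_pi_apply _)
    (P.measurableSet_rectEvent hT n 0 m 0 k)]

/-- A rectangle reads exactly one block more than it contains, so skipping one row or column of
blocks makes the sets of sites disjoint. -/
theorem isRunField_measureReal_rectEvent (P : ScanParams) (hm₁ : 1 ≤ P.m₁) (hm₂ : 1 ≤ P.m₂)
    {T : Matrix (Fin P.c₂) (Fin P.c₁) ℝ → ℝ}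
    (hT : Measurable fun a : Fin P.c₂ → Fin P.c₁ → ℝ => T (Matrix.of a)) (n : ℝ) :
    IsRunField fun m k => (Measure.infinitePi fun _ : ℕ × ℕ => ν).real
      (P.rectEvent T n 0 (m * P.b₁) 0 (k * P.b₂)) := by
  have hmeas := P.measurableSet_rectEvent hT n
  have hshift := P.measureReal_rectEvent_shift ν hT n
  refine ⟨fun k => ?_, fun m => ?_, ?_⟩
  · have h := isRunSeq_measureReal (μ := Measure.infinitePi fun _ : ℕ × ℕ => ν)
      (I := fun s m => P.rectEvent T n (s * P.b₁) (m * P.b₁) 0 (k * P.b₂))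
      (fun s m => hmeas _ _ _ _) (fun s => by simp only [zero_mul, rectEvent_zero_left])
      (fun s m m' => by simp only [add_mul, rectEvent_add_left])
      (fun s m => by rw [hshift, zero_mul])
      (fun m s m' hs => by
        refine measureReal_inter_of_dependsOn ν ?_ (hmeas _ _ _ _) (hmeas _ _ _ _)
          (P.dependsOn_rectEvent hm₁ hm₂ T n _ _ _ _) (P.dependsOn_rectEvent hm₁ hm₂ T n _ _ _ _)
        refine Finset.disjoint_product.2 (.inl (Finset.disjoint_left.2 fun i hi hi' => ?_))
        rw [Finset.mem_Ioc] at hi hi'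
        have := Nat.mul_le_mul_right P.b₁ hs
        rw [add_mul] at this
        omega)
    simpa only [zero_mul] using h
  · have h := isRunSeq_measureReal (μ := Measure.infinitePi fun _ : ℕ × ℕ => ν)
      (I := fun t k => P.rectEvent T n 0 (m * P.b₁) (t * P.b₂) (k * P.b₂))
      (fun t k => hmeas _ _ _ _) (fun t => by simp only [zero_mul, rectEvent_zero_right])
      (fun t k k' => by simp only [add_mul, rectEvent_add_right])
      (fun t k => by rw [hshift, zero_mul])
      (fun k t k' ht => by
        refine measureReal_inter_of_dependsOn ν ?_ (hmeas _ _ _ _) (hmeas _ _ _ _)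
          (P.dependsOn_rectEvent hm₁ hm₂ T n _ _ _ _) (P.dependsOn_rectEvent hm₁ hm₂ T n _ _ _ _)
        refine Finset.disjoint_product.2 (.inr (Finset.disjoint_left.2 fun i hi hi' => ?_))
        rw [Finset.mem_Ioc] at hi hi'
        have := Nat.mul_le_mul_right P.b₂ ht
        rw [add_mul] at this
        omega)
    simpa only [zero_mul] using h
  · have hsub : ∀ t k, P.rectEvent T n 0 (2 * P.b₁) t k ⊆ P.rectEvent T n 0 (1 * P.b₁) t k :=
      fun t k => by
        rw [show 2 * P.b₁ = 1 * P.b₁ + P.b₁ by ring, rectEvent_add_left]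
        exact Set.inter_subset_left
    have hd : ∀ t k, (Measure.infinitePi fun _ : ℕ × ℕ => ν).real
        (P.rectEvent T n 0 (1 * P.b₁) t k \ P.rectEvent T n 0 (2 * P.b₁) t k)
        = (Measure.infinitePi fun _ : ℕ × ℕ => ν).real (P.rectEvent T n 0 (1 * P.b₁) 0 k)
          - (Measure.infinitePi fun _ : ℕ × ℕ => ν).real (P.rectEvent T n 0 (2 * P.b₁) 0 k) :=
      fun t k => by
        rw [measureReal_sdiff (hsub t k) (hmeas _ _ _ _), hshift 0 _ t, hshift 0 _ t]
    rw [← hd 0 (2 * P.b₂), ← hd 0 (1 * P.b₂), two_mul (Measure.real _ _)]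
    nth_rw 2 [hd 0 (1 * P.b₂)]
    rw [← hd P.b₂ (1 * P.b₂)]
    -- If the first column of height two is good and the 2 × 2 square is not, then the same happens
    -- in the lower or in the upper row; the two rows have equal probability.
    refine (measureReal_mono ?_).trans (measureReal_union_le _ _)
    have e : ∀ m, P.rectEvent T n 0 m 0 (2 * P.b₂) = P.rectEvent T n 0 m 0 (1 * P.b₂)
        ∩ P.rectEvent T n 0 m P.b₂ (1 * P.b₂) := fun m => by
      rw [two_mul, rectEvent_add_right, zero_add, one_mul]
    rw [e, e]
    intro f hf
    simp only [Set.mem_sdiff, Set.mem_inter_iff, Set.mem_union] at hf ⊢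
    tauto

end ProductMeasure

end ScanParams

/-! ### Transfer from the given finite sample, and the theorem. -/

/-- The law of finitely many i.i.d. variables, as seen by an event that depends only on them. -/
theorem measureReal_eq_infinitePi_of_dependsOn {Ω ι : Type*} [MeasurableSpace Ω] {μ : Measure Ω}
    [IsProbabilityMeasure μ] {S : Finset ι} {X : ι → Ω → ℝ} {ν : Measure ℝ}
    [IsProbabilityMeasure ν] (hX : ∀ p ∈ S, Measurable (X p))
    (hindep : iIndepFun (fun p : S => X p) μ) (hν : ∀ p ∈ S, μ.map (X p) = ν)
    {A : Set (ι → ℝ)} (hA : MeasurableSet A) (hAS : DependsOn (fun f => f ∈ A) S) :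
    μ.real {ω | (fun p => X p ω) ∈ A} = (Measure.infinitePi fun _ : ι => ν).real A := by
  classical
  have hX' : ∀ p : S, Measurable (X p) := fun p => hX p p.2
  have hlaw : μ.map (fun ω (p : S) => X p ω) = Measure.pi fun _ : S => ν := by
    rw [(iIndepFun_iff_map_fun_eq_pi_map fun p : S => (hX' p).aemeasurable).1 hindep]
    exact congrArg Measure.pi (funext fun p => hν p p.2)
  let ext (z : S → ℝ) (i : ι) : ℝ := if h : i ∈ S then z ⟨i, h⟩ else 0
  have hext : Measurable ext := by
    refine measurable_pi_lambda _ fun i => ?_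
    by_cases h : i ∈ S
    · simpa [ext, h] using measurable_pi_apply _
    · simp [ext, h]
  have hpre : ∀ f : ι → ℝ, ext (fun p : S => f p) ∈ A ↔ f ∈ A := fun f => by
    refine iff_of_eq (hAS fun i hi => ?_)
    simp only [ext]
    rw [dif_pos (Finset.mem_coe.1 hi)]
  have e1 : {ω | (fun p => X p ω) ∈ A} = (fun ω (p : S) => X p ω) ⁻¹' (ext ⁻¹' A) := by
    ext ω
    exact (hpre fun p => X p ω).symm
  have e2 : A = S.restrict ⁻¹' (ext ⁻¹' A) := by
    ext f
    exact (hpre f).symm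
  conv_rhs => rw [e2]
  rw [e1, ← map_measureReal_apply (measurable_pi_lambda _ fun p => hX' p) (hext hA), hlaw,
    ← map_measureReal_apply (Finset.measurable_restrict S) (hext hA),
    Measure.infinitePi_map_restrict]

theorem mainTheorem1 {Ω : Type*} [MeasurableSpace Ω] (μ : Measure Ω) [IsProbabilityMeasure μ]
    (P : ScanParams) (hm₁ : 2 ≤ P.m₁) (hm₂ : 2 ≤ P.m₂) (hL₁ : 1 ≤ P.L₁) (hL₂ : 1 ≤ P.L₂)
    (X : ℕ → ℕ → Ω → ℝ)
    (hX : ∀ p ∈ P.sites, Measurable (X p.1 p.2))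
    (hindep : iIndepFun (fun p : P.sites => X p.1.1 p.1.2) μ)
    (hident : ∀ p ∈ P.sites, ∀ q ∈ P.sites, IdentDistrib (X p.1 p.2) (X q.1 q.2) μ μ)
    (T : Matrix (Fin P.c₂) (Fin P.c₁) ℝ → ℝ) (hT : Measurable fun a : Fin P.c₂ → Fin P.c₁ → ℝ => T (Matrix.of a))
    (n α₁ α₂ l₁ l₂ : ℝ)
    (hl₁ : ScanBound.Admissible α₁ l₁) (hl₂ : ScanBound.Admissible α₂ l₂)
    (Q₂ Q₂₂ Q₂₃ Q₃₂ Q₃₃ R₂ R₃ F₂ F₁ : ℝ)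
    (hQ₂ : Q₂ = P.Qstrip T μ X n 2)
    (hQ₂₂ : Q₂₂ = P.Qblock T μ X n 2 2) (hQ₂₃ : Q₂₃ = P.Qblock T μ X n 2 3)
    (hQ₃₂ : Q₃₂ = P.Qblock T μ X n 3 2) (hQ₃₃ : Q₃₃ = P.Qblock T μ X n 3 3)
    (hR₂ : R₂ = ScanBound.H Q₂₂ Q₃₂ P.L₁) (hR₃ : R₃ = ScanBound.H Q₂₃ Q₃₃ P.L₁)
    (hF₂ : F₂ = ScanBound.F α₁ l₁ P.L₂ Q₂) (hF₁ : F₁ = ScanBound.F α₂ l₂ P.L₁ Q₂₃)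
    (hα₁ : 1 - α₁ ≤ Q₂) (hα₁' : 0.9 ≤ 1 - α₁)
    (hα₂ : 1 - α₂ ≤ Q₂₃) (hα₂' : 0.9 ≤ 1 - α₂) :
    |P.probScan T μ X n - ScanBound.H R₂ R₃ P.L₂|
        ≤ ScanBound.appError P.L₁ P.L₂ F₂ F₁ F₁ R₂ Q₂₂ Q₂₃ ∧
    |P.probScan T μ X n - ScanBound.H R₂ R₃ P.L₂|
        ≤ ScanBound.appError P.L₁ P.L₂ F₂ (ScanBound.F α₂ l₂ P.L₁ Q₂₂) F₁ R₂ Q₂₂ Q₂₃ := by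
  have hb₁ : 1 ≤ P.b₁ := by unfold ScanParams.b₁ ScanParams.c₁; omega
  have hb₂ : 1 ≤ P.b₂ := by unfold ScanParams.b₂ ScanParams.c₂; omega
  have hsite : (1, 1) ∈ P.sites := by
    simp only [ScanParams.sites, Finset.mem_product, Finset.mem_Icc]
    omega
  have hν : IsProbabilityMeasure (μ.map (X 1 1)) :=
    Measure.isProbabilityMeasure_map (hX _ hsite).aemeasurable
  have hG := P.isRunField_measureReal_rectEvent (μ.map (X 1 1)) (by omega) (by omega) hT n
  obtain ⟨G, hGdef⟩ : ∃ G : ℕ → ℕ → ℝ, G = fun m k =>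
      (Measure.infinitePi fun _ : ℕ × ℕ => μ.map (X 1 1)).real
        (P.rectEvent T n 0 (m * P.b₁) 0 (k * P.b₂)) := ⟨_, rfl⟩
  rw [← hGdef] at hG
  -- G lives on the infinite array, so it is defined for all m and k; only the values named in the
  -- theorem are tied to μ. They read (m + 1)b₁ × (k + 1)b₂ sites, and G(2,2) is covered because the
  -- grid has at least three blocks each way.
  have transfer : ∀ m k, 1 ≤ m → 1 ≤ k → m + 1 ≤ max (P.L₁ + 1) 3 → k + 1 ≤ max (P.L₂ + 1) 3 →
      μ.real {ω | P.maxWindow T (fun i j => X i j ω) (m * P.b₁) (k * P.b₂) ≤ n} = G m k := by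
    intro m k hm hk hm' hk'
    have hset : {ω | P.maxWindow T (fun i j => X i j ω) (m * P.b₁) (k * P.b₂) ≤ n}
        = {ω | (fun p : ℕ × ℕ => X p.1 p.2 ω) ∈ P.rectEvent T n 0 (m * P.b₁) 0 (k * P.b₂)} := by
      ext ω
      simp only [Set.mem_ofPred_eq]
      rw [P.maxWindow_le_iff T _ (Nat.mul_pos hm hb₁) (Nat.mul_pos hk hb₂)]
      simp only [ScanParams.rectEvent, Set.mem_ofPred_eq, zero_add]
      rfl
    rw [hset, hGdef]
    refine measureReal_eq_infinitePi_of_dependsOn (S := P.sites) (X := fun p => X p.1 p.2) hX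
      hindep (fun p hp => (hident p hp (1, 1) hsite).map_eq)
      (P.measurableSet_rectEvent hT n _ _ _ _)
      ((P.dependsOn_rectEvent (by omega) (by omega) T n _ _ _ _).mono ?_)
    have hmax : ∀ {a L b : ℕ}, a + 1 ≤ max (L + 1) 3 → a * b + b ≤ max ((L + 1) * b) (3 * b) :=
      fun {a L b} h => by
        rw [← Nat.succ_mul]
        rcases le_max_iff.1 h with h | h
        · exact le_max_of_le_left (Nat.mul_le_mul_right b h)
        · exact le_max_of_le_right (Nat.mul_le_mul_right b h)
    have h1 : m * P.b₁ + P.b₁ ≤ _ := hmax hm'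
    have h2 : k * P.b₂ + P.b₂ ≤ _ := hmax hk'
    refine Finset.coe_subset.2 (Finset.product_subset_product (fun i hi => ?_) fun j hj => ?_)
    · simp only [ScanParams.Ntilde₁, Finset.mem_Ioc, Finset.mem_Icc] at *
      omega
    · simp only [ScanParams.Ntilde₂, Finset.mem_Ioc, Finset.mem_Icc] at *
      omega
  have hS : P.probScan T μ X n = G P.L₁ P.L₂ := by
    unfold ScanParams.probScan ScanParams.scan
    rw [P.N₁_sub hm₁ hL₁, P.N₂_sub hm₂ hL₂]
    exact transfer _ _ hL₁ hL₂ (by omega) (by omega)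
  have hq₂ : Q₂ = G P.L₁ 1 := hQ₂.trans (transfer _ _ hL₁ le_rfl (by omega) (by omega))
  have hq₂₂ : Q₂₂ = G 1 1 := hQ₂₂.trans (transfer 1 1 le_rfl le_rfl (by omega) (by omega))
  have hq₂₃ : Q₂₃ = G 1 2 := hQ₂₃.trans (transfer 1 2 le_rfl (by omega) (by omega) (by omega))
  have hq₃₂ : Q₃₂ = G 2 1 := hQ₃₂.trans (transfer 2 1 (by omega) le_rfl (by omega) (by omega))
  have hq₃₃ : Q₃₃ = G 2 2 := hQ₃₃.trans (transfer 2 2 (by omega) (by omega) (by omega) (by omega))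
  clear hQ₂ hQ₂₂ hQ₂₃ hQ₃₂ hQ₃₃
  subst hq₂ hq₂₂ hq₂₃ hq₃₂ hq₃₃
  have g1 := (hG.row 1).le_one P.L₁
  have g2 := (hG.row 2).le_one 1
  have g3 := (hG.row 1).le_one 1
  have g4 : G 1 2 ≤ G 1 1 := (hG.col 1).anti 1
  have a1 : 0 ≤ α₁ := by linarith
  have a1' : α₁ ≤ 0.1 := by linarith
  have a2 : 0 ≤ α₂ := by linarith
  have a2' : α₂ ≤ 0.1 := by linarith
  rw [hS, hF₂, hF₁]
  have b1 := ScanBound.le_mul_F a1 a1' hl₁ hL₂ (le_refl (G P.L₁ 1)) g1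
  have b3 := ScanBound.le_mul_F a2 a2' hl₂ hL₁ (le_refl (G 1 2)) g2
  -- The factor f₂ must beat a bound in 1 - G(1,1). Since G(1,2) ≤ G(1,1), F evaluated at either of
  -- them does, which gives the two versions.
  exact ⟨hG.abs_sub_H_le hL₁ hL₂ (by linarith) (by linarith) hR₂ hR₃ b1
      (ScanBound.le_mul_F a2 a2' hl₂ hL₁ g4 g3) b3,
    hG.abs_sub_H_le hL₁ hL₂ (by linarith) (by linarith) hR₂ hR₃ b1
      (ScanBound.le_mul_F a2 a2' hl₂ hL₁ le_rfl g3) b3⟩
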